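/- Let $K$ be a field of characteristic zero. A \emph{$K$-variety} is a separated integral scheme of finite type over $K$; a \emph{cover} is a finite surjective morphism of normal $K$-varieties, its degree is the degree of the associated extension of function fields, and it is \emph{ramified} if it is not étale. For a normal $K$-variety $X$, a subset $T\subseteq X(K)$ is \emph{thin} (resp. \emph{strongly thin}) in $X$ if $$T\subseteq C(K)\cup\bigcup_{i=1}^r f_i(Z_i(K))$$ for some proper closed subscheme $C$ of $X$ and finitely many covers $f_i\colon Z_i\to X$, $i=1,\dots,r$ ($r\ge 0$), each of degree $>1$ (resp. each ramified). The variety $X$ has the \emph{Hilbert property} HP (resp. the \emph{weak Hilbert property} WHP) if $X(K)$ is not thin (resp. not strongly thin) in $X$. The field $K$ is \emph{Hilbertian} if $\mathbb{P}^1_K$ has HP. \textbf{Proposition.} If some normal $K$-variety $X$ with $\dim X\ge 1$ has WHP, then $K$ is Hilbertian. -/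

import Mathlib

universe u

open CategoryTheory AlgebraicGeometry

noncomputable section

namespace HilbertProperty

/-- Schemes over a field `K`; morphisms are morphisms of schemes over `Spec K`. -/
abbrev SchemeOver (K : Type u) [Field K] := Over (Spec (CommRingCat.of K))

variable {K : Type u} [Field K]

/-- A `K`-variety: a separated integral scheme of finite type over `K`. -/
structure IsVariety (X : SchemeOver K) : Prop where
  isIntegral : IsIntegral X.left
  isSeparated : IsSeparated X.hom
  locallyOfFiniteType : LocallyOfFiniteType X.hom
  quasiCompact : QuasiCompact X.hom

/-- A normal `K`-variety: every local ring is an integrally closed domain. -/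
structure IsNormalVariety (X : SchemeOver K) : Prop extends IsVariety X where
  isIntegrallyClosed_stalk : ∀ x : X.left, IsIntegrallyClosed (X.left.presheaf.stalk x)

/-- The set `X(K)` of `K`-rational points, that is, of sections of `X ⟶ Spec K`. -/
abbrev Points (X : SchemeOver K) := Over.mk (𝟙 (Spec (CommRingCat.of K))) ⟶ X

/-- `C(K)` as a subset of `X(K)`, for a closed subset `C` of `X`. -/
def pointsIn {X : SchemeOver K} (C : Set X.left) : Set (Points X) :=
  {x | Set.range x.left ⊆ C}

/-- `f(Z(K))` as a subset of `X(K)`, for a morphism `f : Z ⟶ X`. -/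
def pointsImage {Z X : SchemeOver K} (f : Z ⟶ X) : Set (Points X) :=
  Set.range fun z : Points Z => z ≫ f

/-- A cover: a finite surjective morphism of normal `K`-varieties. -/
structure IsCover {Z X : SchemeOver K} (f : Z ⟶ X) : Prop where
  source : IsNormalVariety Z
  target : IsNormalVariety X
  isFinite : IsFinite f.left
  surjective : Surjective f.left

/-- A surjective morphism maps the generic point to the generic point. -/
theorem map_genericPoint {Z X : Scheme.{u}} [IsIntegral Z] [IsIntegral X] (f : Z ⟶ X)
    [Surjective f] : f (genericPoint Z) = genericPoint X := by
  refine ((genericPoint_spec Z).image f.continuous).eq ?_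
  rw [Set.image_univ, f.surjective.range_eq, closure_univ]
  exact genericPoint_spec X

/-- The homomorphism `K(X) → K(Z)` of function fields induced by a surjective morphism `Z ⟶ X` of
integral schemes. -/
def functionFieldMap {Z X : Scheme.{u}} [IsIntegral Z] [IsIntegral X] (f : Z ⟶ X)
    [Surjective f] : X.functionField ⟶ Z.functionField :=
  X.presheaf.stalkSpecializes (specializes_of_eq (map_genericPoint f)) ≫
    f.stalkMap (genericPoint Z)

/-- The degree of a cover `Z ⟶ X`: the degree `[K(Z) : K(X)]` of the extension of function
fields. -/
def IsCover.degree {Z X : SchemeOver K} {f : Z ⟶ X} (hf : IsCover f) : ℕ :=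
  haveI := hf.source.isIntegral
  haveI := hf.target.isIntegral
  haveI := hf.surjective
  letI : Algebra X.left.functionField Z.left.functionField :=
    (functionFieldMap f.left).hom.toAlgebra
  Module.finrank X.left.functionField Z.left.functionField

/-- A cover is ramified if it is not étale. -/
def IsRamified {Z X : SchemeOver K} (f : Z ⟶ X) : Prop :=
  ¬ Etale f.left

/-- `T ⊆ X(K)` is thin if it is contained in the union of `C(K)`, for a proper closed subset `C`
of `X`, and of finitely many sets `fᵢ(Zᵢ(K))`, for covers `fᵢ : Zᵢ ⟶ X` of degree `> 1`. -/
def IsThin {X : SchemeOver K} (T : Set (Points X)) : Prop :=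
  ∃ C : Set X.left, IsClosed C ∧ C ≠ Set.univ ∧
    ∃ (r : ℕ) (Z : Fin r → SchemeOver K) (f : ∀ i, Z i ⟶ X),
      (∀ i, ∃ hf : IsCover (f i), 1 < hf.degree) ∧
        T ⊆ pointsIn C ∪ ⋃ i, pointsImage (f i)

/-- `T ⊆ X(K)` is strongly thin if it is contained in the union of `C(K)`, for a proper closed
subset `C` of `X`, and of finitely many sets `fᵢ(Zᵢ(K))`, for ramified covers `fᵢ : Zᵢ ⟶ X`. -/
def IsStronglyThin {X : SchemeOver K} (T : Set (Points X)) : Prop :=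
  ∃ C : Set X.left, IsClosed C ∧ C ≠ Set.univ ∧
    ∃ (r : ℕ) (Z : Fin r → SchemeOver K) (f : ∀ i, Z i ⟶ X),
      (∀ i, IsCover (f i) ∧ IsRamified (f i)) ∧
        T ⊆ pointsIn C ∪ ⋃ i, pointsImage (f i)

/-- The Hilbert property of a normal `K`-variety `X`: the set `X(K)` is not thin. -/
def HasHP (X : SchemeOver K) : Prop :=
  ¬ IsThin (Set.univ : Set (Points X))

/-- The weak Hilbert property of a normal `K`-variety `X`: the set `X(K)` is not strongly thin. -/
def HasWHP (X : SchemeOver K) : Prop :=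
  ¬ IsStronglyThin (Set.univ : Set (Points X))

/-- The projective line over `K`: the homogeneous spectrum of `K[X₀, X₁]` with its standard
grading, over `Spec K`. -/
def projectiveLine (K : Type u) [Field K] : SchemeOver K :=
  letI := MvPolynomial.gradedAlgebra (σ := Fin 2) (R := K)
  Over.mk (Proj.toSpecZero (MvPolynomial.homogeneousSubmodule (Fin 2) K) ≫
    Spec.map (CommRingCat.ofHom
      (algebraMap K (MvPolynomial.homogeneousSubmodule (Fin 2) K 0))))

/-- `K` is Hilbertian if the projective line over `K` has the Hilbert property. -/
def IsHilbertian (K : Type u) [Field K] : Prop :=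
  HasHP (projectiveLine K)

end HilbertProperty

end

/-! The proof is by contraposition: a thin `ℙ¹(K)` is pulled back to `X` in such a way that every
cover obtained is ramified.

If `ℙ¹(K)` is thin, integral primitive elements of the covers over the chart `Spec K[t]` give
finitely many monic irreducible `f ∈ K[t][Y]` of degree at least 2 such that, for all but finitely
many `a ∈ K`, some `f(a, Y)` has a root in `K` (`exists_polynomials_of_isThin`).

Each `f` falls under one of two cases (`exists_ramified_or_finite`). If its function field contains
new constants, `f` has rational points over finitely many `a` only, and can be dropped. Otherwise
the cover of the affine line is ramified over some closed point `p = 0`, because in characteristic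
zero the affine line has no unramified covers except constant ones
(`exists_ramified_of_adjoin_ne_top`). Ramification is expressed algebraically: the integral closure
of `K[t]` is not reduced modulo `p`. Simple connectedness is proved with the derivation `d/dt`: it
preserves the integral closure of `K[t]` when this is reduced modulo every `p`, and it lowers pole
orders at infinity, so every integral element is obtained by integrating a polynomial.

On an affine open `Spec A` of `X` of positive dimension, Noether normalization gives a function `φ`,
a translate of one coordinate, whose fibres over the finitely many branch points in question avoid
the bad locus of the normalization generically. An étale cover of `A` would then force reducedness
over `p` (`exists_parameter`), so every factor of `f(φ, Y)` yields a ramified normal cover of `A`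
(`not_etale_integralClosure`). A rational point of `Spec A` outside a proper closed subset maps
under `φ` to a value where some `f` has a root, hence lifts to one of these covers. Globalizing by
normalization of `X` in field extensions shows that `X(K)` is strongly thin (`isStronglyThin_univ`).
-/

noncomputable section

/-! ### Derivations and reduced fibres -/

namespace HilbertProperty

open Polynomial

variable {K E : Type*} [Field K] [Field E] [Algebra K E]

/-- One step in reducing the denominators of a derivation on a subring modulo a reduced element. -/
theorem derivation_denominator_step [CharZero K] (O : Subalgebra K E) (D : Derivation K E E)
    {p d : E}
    (hrad : ∀ x ∈ O, ∀ z ∈ O, ∀ n : ℕ, x ^ n = p * z → ∃ c ∈ O, x = p * c)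
    (hq : ∀ x ∈ O, ∃ f : K[X], f ≠ 0 ∧ ∃ b ∈ O, aeval x f = p * b)
    (hdp : d * D p ∈ O) (hD : ∀ x ∈ O, d * p * D x ∈ O) :
    ∀ x ∈ O, d * D x ∈ O := by
  intro x hx
  obtain ⟨f, hf0, b, hb, hfb⟩ := hq x hx
  classical
  -- Passing to the radical makes the polynomial separable in characteristic zero, while reducedness
  -- modulo `p` keeps its value at `x` in `pO`. Differentiating `q(x) = p c` then bounds `q'(x) D
  -- x`, and a Bézout relation between `q` and `q'` bounds `D x` itself.
  set q := UniqueFactorizationMonoid.radical f with hqdef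
  have hsep : q.Separable :=
    PerfectField.separable_iff_squarefree.mpr UniqueFactorizationMonoid.squarefree_radical
  have hmem : ∀ g : K[X], aeval x g ∈ O := fun g => by
    have := aeval_algHom_apply O.val ⟨x, hx⟩ g
    have h2 : aeval x g = O.val (aeval (⟨x, hx⟩ : O) g) := this
    rw [h2]; exact (aeval (⟨x, hx⟩ : O) g).2
  obtain ⟨n, g, hn⟩ : ∃ n, f ∣ q ^ n :=
    UniqueFactorizationMonoid.exists_dvd_radical_self_pow hf0
  obtain ⟨c, hc, hqc⟩ : ∃ c ∈ O, aeval x q = p * c := by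
    refine hrad _ (hmem q) (b * aeval x g) (O.mul_mem hb (hmem g)) n ?_
    rw [← map_pow, hn, map_mul, hfb]; ring
  obtain ⟨a, a', haa⟩ := hsep
  have h1 : aeval x a * aeval x q + aeval x a' * aeval x (derivative q) = 1 := by
    rw [← map_mul, ← map_mul, ← map_add, haa, map_one]
  have h2 : aeval x (derivative q) * D x = D p * c + p * D c := by
    have := D.map_aeval q x
    rw [hqc, D.leibniz] at this
    simp only [smul_eq_mul] at this
    rw [← this]; ring
  have h3 : d * D x = aeval x a * c * (d * p * D x) +
      aeval x a' * (d * D p * c + d * p * D c) := by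
    linear_combination (-(d * D x)) * h1 + aeval x a * d * D x * hqc + aeval x a' * d * h2
  rw [h3]
  exact O.add_mem (O.mul_mem (O.mul_mem (hmem a) hc) (hD x hx))
    (O.mul_mem (hmem a') (O.add_mem (O.mul_mem hdp hc) (hD c hc)))

/-- The elements `p` and `x` satisfy an algebraic relation. After division by the largest possible
power of the variable standing for `p`, its constant term in that variable is a nonzero polynomial
in `x` lying in `pO`. This replaces finiteness of the residue fields over `K`. -/
theorem exists_aeval_eq_mul_of_trdeg_le_one (htr : Algebra.trdeg K E ≤ 1) (O : Subalgebra K E)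
    {x p : E} (hx : x ∈ O) (hp : p ∈ O) (hp0 : p ≠ 0) :
    ∃ f : K[X], f ≠ 0 ∧ ∃ b ∈ O, aeval x f = p * b := by
  have hdep : ¬ AlgebraicIndependent K ![p, x] := by
    intro h
    have h1 := h.lift_cardinalMk_le_trdeg
    have h2 : Cardinal.lift.{0} (Algebra.trdeg K E) ≤ 1 := by simpa using htr
    have h3 := h1.trans h2
    simp at h3
  rw [algebraicIndependent_iff] at hdep
  push Not at hdep
  obtain ⟨P, hP, hP0⟩ := hdep
  -- The outer variable stands for `p` and the inner one for `x`.
  let e : MvPolynomial (Fin 2) K ≃ₐ[K] K[X][X] := (MvPolynomial.finSuccEquiv K 1).trans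
    (Polynomial.mapAlgEquiv (MvPolynomial.uniqueAlgEquiv K (Fin 1)))
  have he : (aevalAeval x p).comp e.toAlgHom = MvPolynomial.aeval ![p, x] := by
    ext i
    fin_cases i
    · change aevalAeval x p (e (MvPolynomial.X 0)) = MvPolynomial.aeval ![p, x] (MvPolynomial.X 0)
      simp [e, MvPolynomial.finSuccEquiv_X_zero]
    · change aevalAeval x p (e (MvPolynomial.X (Fin.succ 0))) =
        MvPolynomial.aeval ![p, x] (MvPolynomial.X 1)
      have h1 : e (MvPolynomial.X (Fin.succ 0)) = C X := by
        simp only [e, AlgEquiv.trans_apply, MvPolynomial.finSuccEquiv_X_succ]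
        simp
      rw [h1, aevalAeval_X]
      simp
  have hQ : aevalAeval x p (e P) = 0 := by
    rw [← hP, ← he]; rfl
  have hQ0 : e P ≠ 0 := by simpa using hP0
  obtain ⟨k, Q, hXQ, hPQ⟩ := WfDvdMonoid.max_power_factor hQ0 (Polynomial.irreducible_X)
  rw [hPQ, map_mul, map_pow, aevalAeval_Y] at hQ
  have hQ1 := (mul_eq_zero.mp hQ).resolve_left (pow_ne_zero _ hp0)
  have hmem : ∀ g : K[X][X], aevalAeval x p g ∈ O := fun g => by
    have : (aevalAeval x p : K[X][X] →ₐ[K] E) = O.val.comp (aevalAeval ⟨x, hx⟩ ⟨p, hp⟩) := by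
      ext <;> simp
    rw [this]; exact Subtype.prop _
  refine ⟨Q.coeff 0, fun h => hXQ (X_dvd_iff.mpr h), _, O.neg_mem (hmem Q.divX), ?_⟩
  rw [← Q.divX_mul_X_add, map_add, map_mul, aevalAeval_Y, aevalAeval_C] at hQ1
  linear_combination hQ1

end HilbertProperty

end

/-! ### Derivations of function fields and integrality over `K[t]` and `K[1/t]` -/

noncomputable section

namespace HilbertProperty

open Polynomial IntermediateField IntermediateField.algebraAdjoinAdjoin
open scoped TensorProduct

/-- A derivation extends along a formally étale algebra. -/
theorem exists_derivation_of_formallyEtale (R : Type*) {S T : Type*} [CommRing R] [CommRing S]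
    [CommRing T] [Algebra R S] [Algebra R T] [Algebra S T] [IsScalarTower R S T]
    [Algebra.FormallyEtale S T] (D : Derivation R S T) :
    ∃ D' : Derivation R T T, ∀ s, D' (algebraMap S T s) = D s := by
  refine ⟨(D.liftKaehlerDifferential.liftBaseChange T ∘ₗ
    (KaehlerDifferential.tensorKaehlerEquivOfFormallyEtale R S T).symm.toLinearMap).compDer
      (KaehlerDifferential.D R T), fun s => ?_⟩
  simp [KaehlerDifferential.tensorKaehlerEquivOfFormallyEtale_symm_D_algebraMap]

variable {K E : Type*} [Field K] [Field E] [Algebra K E]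

/-- The derivation `d/dt` of `K[t]` extends to `K(t)` by localization and then to `E`, which is
separable over `K(t)` in characteristic zero; both steps are formally étale. -/
theorem exists_derivation_apply_eq_one [CharZero K] {t : E} (ht : Transcendental K t)
    [Algebra.IsAlgebraic K⟮t⟯ E] : ∃ D : Derivation K E E, D t = 1 := by
  let e : K[X] ≃ₐ[K] Algebra.adjoin K {t} :=
    (AlgEquiv.ofInjective (aeval t) (transcendental_iff_injective.mp ht)).trans
      (Subalgebra.equivOfEq _ _ (Algebra.adjoin_singleton_eq_range_aeval K t).symm)
  have he : ∀ f, (e f : E) = aeval t f := fun f => rfl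
  have he' : ∀ r, aeval t (e.symm r) = (r : E) := fun r => by
    rw [← he, AlgEquiv.apply_symm_apply]
  have : Algebra.FormallyEtale (Algebra.adjoin K {t}) K⟮t⟯ :=
    Algebra.FormallyEtale.of_isLocalization (nonZeroDivisors (Algebra.adjoin K {t}))
  have : CharZero K⟮t⟯ := charZero_of_injective_algebraMap (algebraMap K K⟮t⟯).injective
  have : Algebra.FormallyEtale K⟮t⟯ E := Algebra.FormallyEtale.of_isSeparable _ _
  have : Algebra.FormallyEtale (Algebra.adjoin K {t}) E := Algebra.FormallyEtale.comp _ K⟮t⟯ _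
  let D₀ : Derivation K (Algebra.adjoin K {t}) E := Derivation.mk'
    ((aeval t).toLinearMap ∘ₗ derivative ∘ₗ e.symm.toLinearMap) fun a b => by
      simp [Algebra.smul_def, he']
      ring
  obtain ⟨D, hD⟩ := exists_derivation_of_formallyEtale K D₀
  refine ⟨D, ?_⟩
  have h := hD (e X)
  have h1 : algebraMap (Algebra.adjoin K {t}) E (e X) = t := by
    change ((e X : Algebra.adjoin K {t}) : E) = t
    rw [he, aeval_X]
  rw [h1] at h
  rw [h]
  simp [D₀]

/-- A function regular everywhere on a complete curve is constant. Any valuation ring of `E`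
containing `K` contains `t` or `t⁻¹`, hence `b`, and the intersection of all these rings is the
integral closure of `K`. -/
theorem isIntegral_of_isIntegral_adjoin_inv {t b : E}
    (hb : IsIntegral (Algebra.adjoin K {t}) b) (hb' : IsIntegral (Algebra.adjoin K {t⁻¹}) b) :
    IsIntegral K b := by
  have key : ∀ (V : ValuationSubring E) (x : E), Set.range (algebraMap K E) ⊆ V.toSubring →
      x ∈ V → IsIntegral (Algebra.adjoin K {x}) b → b ∈ V := by
    intro V x hV hx ⟨p, hp, hpb⟩
    have hle : ∀ y ∈ Algebra.adjoin K {x}, y ∈ V.toSubring := fun y hy => by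
      induction hy using Algebra.adjoin_induction with
      | mem y hy => rw [Set.mem_singleton_iff.mp hy]; exact hx
      | algebraMap r => exact hV ⟨r, rfl⟩
      | add _ _ _ _ h1 h2 => exact add_mem h1 h2
      | mul _ _ _ _ h1 h2 => exact mul_mem h1 h2
    let φ : Algebra.adjoin K {x} →+* V :=
      (Algebra.adjoin K {x}).subtype.codRestrict V.toSubring fun y => hle y y.2
    have hVb : IsIntegral V b := ⟨p.map φ, hp.map φ, by rw [eval₂_map]; exact hpb⟩
    obtain ⟨y, rfl⟩ := IsIntegrallyClosed.isIntegral_iff.mp hVb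
    exact y.2
  have hmem : b ∈ (integralClosure (Subring.closure (Set.range (algebraMap K E))) E).toSubring := by
    rw [← iInf_valuationSubring_superset, Subring.mem_iInf]
    rintro ⟨V, hV⟩
    rcases V.mem_or_inv_mem t with h | h
    · exact key V t hV h hb
    · exact key V _ hV h hb'
  have hcl : Subring.closure (Set.range (algebraMap K E)) = (algebraMap K E).range := by
    rw [← RingHom.coe_range, Subring.closure_eq]
  rw [hcl] at hmem
  obtain ⟨p, hp, hpb⟩ := hmem
  obtain ⟨q, hq, hqd, hqm⟩ := lifts_and_natDegree_eq_and_monic (p := p.map (algebraMap _ E))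
    (f := algebraMap K E) ((lifts_iff_coeff_lifts _).mpr fun n => by
      rw [coeff_map]; exact (p.coeff n).2) (hp.map _)
  exact ⟨q, hqm, by rw [← Polynomial.eval_map, hq, Polynomial.eval_map]; exact hpb⟩

theorem exists_pow_inv_mul_mem_adjoin_inv {t c : E} (ht0 : t ≠ 0) (hc : c ∈ Algebra.adjoin K {t}) :
    ∃ N : ℕ, ∀ n ≥ N, t⁻¹ ^ n * c ∈ Algebra.adjoin K {t⁻¹} := by
  have ht : t⁻¹ ∈ Algebra.adjoin K {t⁻¹} := Algebra.self_mem_adjoin_singleton K _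
  induction hc using Algebra.adjoin_induction with
  | mem y hy =>
    refine ⟨1, fun n hn => ?_⟩
    obtain ⟨m, rfl⟩ := Nat.exists_eq_add_of_le' hn
    rw [Set.mem_singleton_iff.mp hy, pow_succ, mul_assoc, inv_mul_cancel₀ ht0, mul_one]
    exact pow_mem ht m
  | algebraMap r => exact ⟨0, fun n _ => mul_mem (pow_mem ht n) (Subalgebra.algebraMap_mem _ r)⟩
  | add x y _ _ h1 h2 =>
    obtain ⟨N, hN⟩ := h1
    obtain ⟨M, hM⟩ := h2
    refine ⟨max N M, fun n hn => ?_⟩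
    rw [mul_add]
    exact add_mem (hN n (le_of_max_le_left hn)) (hM n (le_of_max_le_right hn))
  | mul x y _ _ h1 h2 =>
    obtain ⟨N, hN⟩ := h1
    obtain ⟨M, hM⟩ := h2
    refine ⟨N + M, fun n hn => ?_⟩
    obtain ⟨m, rfl⟩ := Nat.exists_eq_add_of_le hn
    have : t⁻¹ ^ (N + M + m) * (x * y) = t⁻¹ ^ (N + m) * x * (t⁻¹ ^ M * y) := by ring
    rw [this]
    exact mul_mem (hN _ (Nat.le_add_right _ _)) (hM _ le_rfl)

/-- The pole orders of `b` at infinity are bounded. Multiplying the roots of a monic equation of `b`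
by `t⁻¹ ^ M` multiplies each non-leading coefficient by at least one factor `t⁻¹ ^ M`, which clears
its poles at infinity. -/
theorem exists_pow_inv_mul_isIntegral_adjoin_inv {t b : E} (ht0 : t ≠ 0)
    (hb : IsIntegral (Algebra.adjoin K {t}) b) :
    ∃ n : ℕ, IsIntegral (Algebra.adjoin K {t⁻¹}) (t⁻¹ ^ n * b) := by
  obtain ⟨p, hp, hpb⟩ := hb
  choose N hN using fun i : ℕ => exists_pow_inv_mul_mem_adjoin_inv ht0 (p.coeff i).2
  let M := (Finset.range (p.natDegree + 1)).sup N
  refine ⟨M, ?_⟩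
  set q := p.map (algebraMap (Algebra.adjoin K {t}) E) with hq
  have hqm : q.Monic := hp.map _
  have hqd : q.natDegree = p.natDegree := hp.natDegree_map _
  obtain ⟨r, hr, -, hrm⟩ := lifts_and_natDegree_eq_and_monic (p := q.scaleRoots (t⁻¹ ^ M))
    (f := algebraMap (Algebra.adjoin K {t⁻¹}) E) ((lifts_iff_coeff_lifts _).mpr fun i => by
      rw [coeff_scaleRoots, hqd]
      suffices q.coeff i * (t⁻¹ ^ M) ^ (p.natDegree - i) ∈ Algebra.adjoin K {t⁻¹} from
        ⟨⟨_, this⟩, rfl⟩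
      rcases lt_trichotomy i p.natDegree with h | h | h
      · obtain ⟨k, hk⟩ := Nat.exists_eq_add_of_lt h
        have h1 : p.natDegree - i = k + 1 := by omega
        rw [h1, pow_succ', ← mul_assoc, mul_comm (q.coeff i)]
        refine mul_mem ?_ (pow_mem (pow_mem (Algebra.self_mem_adjoin_singleton K _) _) _)
        rw [hq, coeff_map]
        exact hN i M (Finset.le_sup (f := N) (Finset.mem_range.mpr (by omega)))
      · rw [h, ← hqd, coeff_natDegree, hqm.leadingCoeff]
        simp
      · rw [coeff_eq_zero_of_natDegree_lt (hqd ▸ h), zero_mul]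
        exact zero_mem _) ((monic_scaleRoots_iff _).mpr hqm)
  refine ⟨r, hrm, ?_⟩
  rw [← Polynomial.eval_map, hr]
  have := scaleRoots_eval₂_eq_zero (p := q) (RingHom.id E) (r := b) (s := t⁻¹ ^ M)
    (by rw [eval₂_id, hq, Polynomial.eval_map]; exact hpb)
  simpa using this

/-- A derivation preserving `R` has bounded denominators on the integral closure of `R`. -/
theorem exists_mul_derivation_isIntegral (R : Subalgebra K E) [Algebra.IsAlgebraic R E]
    [Module.Finite R (integralClosure R E)] (D : Derivation K E E) (hD : ∀ r ∈ R, D r ∈ R) :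
    ∃ d ∈ R, d ≠ 0 ∧ ∀ x, IsIntegral R x → IsIntegral R (d * D x) := by
  obtain ⟨s, hs⟩ := Module.Finite.fg_top (R := R) (M := integralClosure R E)
  have hex : ∀ z : E, ∃ d ∈ R, d ≠ 0 ∧ IsIntegral R (d * z) := fun z => by
    obtain ⟨y, hy, h⟩ := (Algebra.IsAlgebraic.isAlgebraic (R := R) z).exists_integral_multiple
    exact ⟨y, y.2, by simpa using hy, by simpa [Algebra.smul_def] using h⟩
  choose d hdR hd0 hd using hex
  -- A common denominator for the derivatives of finitely many module generators suffices: by the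
  -- Leibniz rule, an `R`-linear combination only adds terms with coefficients in `D R ⊆ R`.
  refine ⟨∏ g ∈ s, d (D g), prod_mem fun g _ => hdR _,
    Finset.prod_ne_zero_iff.mpr fun g _ => hd0 _, fun x hx => ?_⟩
  have hRint : ∀ r ∈ R, IsIntegral R r := fun r hr => isIntegral_algebraMap (x := (⟨r, hr⟩ : R))
  have hx' : (⟨x, hx⟩ : integralClosure R E) ∈ Submodule.span R (s : Set (integralClosure R E)) := by
    rw [hs]; trivial
  suffices ∀ y : integralClosure R E, y ∈ Submodule.span R (s : Set (integralClosure R E)) →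
      IsIntegral R ((∏ g ∈ s, d (D g)) * D y) from this _ hx'
  intro y hy
  induction hy using Submodule.span_induction with
  | mem y hy =>
    classical
    rw [← Finset.mul_prod_erase s _ hy, mul_right_comm]
    exact (hd _).mul (hRint _ (prod_mem fun g _ => hdR _))
  | zero => simp [isIntegral_zero]
  | add x y _ _ h1 h2 => simpa [mul_add] using h1.add h2
  | smul r y _ h =>
    have : D ((r • y : integralClosure R E) : E) = r * D y + y * D r := by
      simp [Algebra.smul_def]
    rw [this, mul_add]
    refine IsIntegral.add ?_ ?_
    · rw [mul_left_comm]; exact (hRint _ r.2).mul h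
    · exact (hRint _ (prod_mem fun g _ => hdR _)).mul (y.2.mul (hRint _ (hD _ r.2)))

end HilbertProperty

end

/-! ### Simple connectedness of the affine line in characteristic zero -/

noncomputable section

namespace HilbertProperty

open Polynomial IntermediateField IntermediateField.algebraAdjoinAdjoin

variable {K E : Type*} [Field K] [Field E] [Algebra K E]

theorem isAlgebraic_adjoin_of_isAlgebraic (t : E) [Algebra.IsAlgebraic K⟮t⟯ E] :
    Algebra.IsAlgebraic (Algebra.adjoin K {t}) E :=
  Algebra.IsAlgebraic.trans _ K⟮t⟯ _

theorem trdeg_le_one_of_isAlgebraic (t : E) [Algebra.IsAlgebraic K⟮t⟯ E] :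
    Algebra.trdeg K E ≤ 1 := by
  have := isAlgebraic_adjoin_of_isAlgebraic (K := K) t
  simpa using Algebra.IsAlgebraic.trdeg_le_cardinalMk K ({t} : Set E)

theorem isPrincipalIdealRing_adjoin_singleton (t : E) :
    IsPrincipalIdealRing (Algebra.adjoin K {t}) := by
  rw [Algebra.adjoin_singleton_eq_range_aeval]
  exact IsPrincipalIdealRing.of_surjective _ (aeval t : K[X] →ₐ[K] E).rangeRestrict_surjective

theorem finite_integralClosure_adjoin [CharZero K] (t : E) [FiniteDimensional K⟮t⟯ E] :
    Module.Finite (Algebra.adjoin K {t}) (integralClosure (Algebra.adjoin K {t}) E) := by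
  have := isPrincipalIdealRing_adjoin_singleton (K := K) t
  have : CharZero K⟮t⟯ := charZero_of_injective_algebraMap (algebraMap K K⟮t⟯).injective
  exact IsIntegralClosure.finite _ K⟮t⟯ E _

theorem derivation_mem_adjoin_singleton (D : Derivation K E E) {t : E}
    (ht : D t ∈ Algebra.adjoin K {t}) : ∀ r ∈ Algebra.adjoin K {t}, D r ∈ Algebra.adjoin K {t} := by
  intro r hr
  induction hr using Algebra.adjoin_induction with
  | mem y hy => rwa [Set.mem_singleton_iff.mp hy]
  | algebraMap r => rw [D.map_algebraMap]; exact zero_mem _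
  | add x y _ _ h1 h2 => rw [map_add]; exact add_mem h1 h2
  | mul x y hx hy h1 h2 =>
    rw [D.leibniz]
    exact add_mem (mul_mem hx h2) (mul_mem hy h1)

/-- Elements killed by a nonzero derivation of a function field of one variable are constants. -/
theorem isAlgebraic_of_derivation_eq_zero [CharZero K] (htr : Algebra.trdeg K E ≤ 1)
    (D : Derivation K E E) {t c : E} (hDt : D t ≠ 0) (hDc : D c = 0) : IsAlgebraic K c := by
  by_contra hc
  have hind : AlgebraicIndependent K (fun _ : Unit => c) :=
    (algebraicIndependent_singleton_iff ()).mpr hc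
  have hb := hind.isTranscendenceBasis_of_lift_trdeg_le_of_finite (by simpa using htr)
  have halg : Algebra.IsAlgebraic (Algebra.adjoin K (Set.range fun _ : Unit => c)) E :=
    hb.isAlgebraic
  rw [Set.range_const] at halg
  have halg' : IsAlgebraic K⟮c⟯ t :=
    (halg.isAlgebraic t).extendScalars (FaithfulSMul.algebraMap_injective _ _)
  have hvan : ∀ x ∈ K⟮c⟯, D x = 0 := fun x hx => by
    induction hx using IntermediateField.adjoin_induction with
    | mem y hy => rw [Set.mem_singleton_iff.mp hy, hDc]
    | algebraMap r => exact D.map_algebraMap r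
    | add x y _ _ h1 h2 => rw [map_add, h1, h2, add_zero]
    | inv x _ h => rw [D.leibniz_inv, h, smul_zero]
    | mul x y _ _ h1 h2 => rw [D.leibniz, h1, h2, smul_zero, smul_zero, add_zero]
  -- If `c` were transcendental, `t` would be algebraic over `K(c)`. Since `D` kills `K(c)`, it is
  -- `K(c)`-linear, and differentiating the separable minimal equation of `t` forces `D t = 0`.
  let D' : Derivation K⟮c⟯ E E := Derivation.mk'
    { toFun := D
      map_add' := map_add D
      map_smul' := fun a x => by
        rw [Algebra.smul_def, D.leibniz, RingHom.id_apply]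
        have : D (algebraMap K⟮c⟯ E a) = 0 := hvan _ a.2
        rw [this, smul_zero, add_zero]
        rfl }
    fun a b => D.leibniz a b
  have : CharZero K⟮c⟯ := charZero_of_injective_algebraMap (algebraMap K K⟮c⟯).injective
  have h1 := D'.map_aeval (minpoly K⟮c⟯ t) t
  rw [minpoly.aeval, map_zero, smul_eq_mul] at h1
  exact mul_ne_zero ((minpoly.irreducible halg'.isIntegral).separable.aeval_derivative_ne_zero
    (minpoly.aeval _ _)) hDt h1.symm

/-- If `E` is unramified over the affine line with coordinate `t`, then the ring of functions
integral over `K[t]` is stable under `d/dt`. -/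
theorem derivation_isIntegral_adjoin [CharZero K] {t : E} (ht : Transcendental K t)
    [FiniteDimensional K⟮t⟯ E] (D : Derivation K E E) (hDt : D t = 1)
    (hrad : ∀ p : K[X], Irreducible p → ∀ x z : E, IsIntegral (Algebra.adjoin K {t}) x →
      IsIntegral (Algebra.adjoin K {t}) z → ∀ n : ℕ, x ^ n = aeval t p * z →
      IsIntegral (Algebra.adjoin K {t}) (x / aeval t p)) {x : E}
    (hx : IsIntegral (Algebra.adjoin K {t}) x) : IsIntegral (Algebra.adjoin K {t}) (D x) := by
  have := isAlgebraic_adjoin_of_isAlgebraic (K := K) t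
  have := finite_integralClosure_adjoin (K := K) t
  obtain ⟨d, hd, hd0, hdD⟩ := exists_mul_derivation_isIntegral (Algebra.adjoin K {t}) D
    (derivation_mem_adjoin_singleton D (hDt ▸ one_mem _))
  rw [Algebra.adjoin_singleton_eq_range_aeval] at hd
  obtain ⟨f, rfl⟩ := hd
  have hf0 : f ≠ 0 := fun h => hd0 (by simp [h])
  let O : Subalgebra K E := (integralClosure (Algebra.adjoin K {t}) E).restrictScalars K
  have hO : ∀ y, y ∈ O ↔ IsIntegral (Algebra.adjoin K {t}) y := fun y => Iff.rfl
  have hOp : ∀ g : K[X], aeval t g ∈ O := fun g => by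
    have : aeval t g ∈ Algebra.adjoin K {t} := by
      rw [Algebra.adjoin_singleton_eq_range_aeval]; exact ⟨g, rfl⟩
    exact isIntegral_algebraMap (x := (⟨_, this⟩ : Algebra.adjoin K {t}))
  have hinj := transcendental_iff_injective.mp ht
  clear hd0
  -- A common denominator `f(t)` exists; its irreducible factors are removed one at a time by
  -- `derivation_denominator_step`.
  suffices H : ∀ g : K[X], g ≠ 0 → (∀ y ∈ O, aeval t g * D y ∈ O) → ∀ y ∈ O, D y ∈ O from
    H f hf0 (fun y hy => hdD y hy) x hx
  intro g
  induction g using WfDvdMonoid.induction_on_irreducible with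
  | zero => intro h; exact absurd rfl h
  | unit g hg =>
    intro _ h y hy
    obtain ⟨g', hg'⟩ := hg.exists_left_inv
    have : D y = aeval t g' * (aeval t g * D y) := by
      rw [← mul_assoc, ← map_mul, hg', map_one, one_mul]
    rw [this]
    exact mul_mem (hOp _) (h y hy)
  | mul g p hg0 hp ih =>
    intro _ h
    refine ih hg0 (derivation_denominator_step O D (p := aeval t p) ?_ ?_ ?_ ?_)
    · intro y hy z hz n hyz
      have hp0 : aeval t p ≠ 0 := fun h0 => hp.ne_zero (hinj (by simpa using h0))
      exact ⟨_, hrad p hp y z hy hz n hyz, by field_simp⟩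
    · intro y hy
      exact exists_aeval_eq_mul_of_trdeg_le_one (trdeg_le_one_of_isAlgebraic t) O hy (hOp p)
        fun h0 => hp.ne_zero (hinj (by simpa using h0))
    · rw [D.map_aeval, hDt, smul_eq_mul, mul_one]
      exact mul_mem (hOp _) (hOp _)
    · intro y hy
      rw [← map_mul, mul_comm g p]
      exact h y hy

/-- A derivation which is logarithmic at a discrete valuation ring of residue characteristic zero
preserves this ring. -/
theorem derivation_mem_of_isDiscreteValuationRing [CharZero K] (htr : Algebra.trdeg K E ≤ 1)
    (O : Subalgebra K E) [IsDiscreteValuationRing O] (D : Derivation K E E) {u : E} (hu : u ∈ O)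
    (hu0 : u ≠ 0) (hunit : u⁻¹ ∉ O) (hDu : D u = u)
    (hbound : ∃ d ∈ O, d ≠ 0 ∧ ∀ x ∈ O, d * D x ∈ O) : ∀ x ∈ O, D x ∈ O := by
  obtain ⟨ϖ, hϖ⟩ := IsDiscreteValuationRing.exists_irreducible O
  have hunits : ∀ ε : Oˣ, ((ε : O) : E)⁻¹ ∈ O := fun ε => by
    have h : ((ε : O) : E) * ((ε⁻¹ : Oˣ) : O) = 1 := by
      rw [← Subalgebra.coe_mul, Units.mul_inv]; rfl
    rw [inv_eq_of_mul_eq_one_right h]; exact Subtype.prop _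
  have hunits0 : ∀ ε : Oˣ, ((ε : O) : E) ≠ 0 := fun ε h => ε.ne_zero (Subtype.ext h)
  have hϖ0 : (ϖ : E) ≠ 0 := fun h => hϖ.ne_zero (Subtype.ext h)
  obtain ⟨d, hd, hd0, hdD⟩ := hbound
  obtain ⟨N, ε, hε⟩ := IsDiscreteValuationRing.eq_unit_mul_pow_irreducible
    (x := (⟨d, hd⟩ : O)) (fun h => hd0 (congrArg Subtype.val h)) hϖ
  replace hε : d = (ε : O) * (ϖ : E) ^ N := congrArg Subtype.val hε
  obtain ⟨e, η, hη⟩ := IsDiscreteValuationRing.eq_unit_mul_pow_irreducible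
    (x := (⟨u, hu⟩ : O)) (fun h => hu0 (congrArg Subtype.val h)) hϖ
  replace hη : u = (η : O) * (ϖ : E) ^ e := congrArg Subtype.val hη
  have hbase : ∀ x ∈ O, (ϖ : E) ^ N * D x ∈ O := fun x hx => by
    have : (ϖ : E) ^ N * D x = ((ε : O) : E)⁻¹ * (d * D x) := by
      rw [hε]; field_simp [hunits0 ε]
    rw [this]
    exact mul_mem (hunits ε) (hdD x hx)
  have hchar : CharZero E := charZero_of_injective_algebraMap (algebraMap K E).injective
  -- Here `e` is the ramification index at `u = 0`; it is positive because `u` is not a unit.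
  obtain ⟨m, rfl⟩ : ∃ m, e = m + 1 := by
    refine Nat.exists_eq_succ_of_ne_zero fun he => hunit ?_
    rw [hη, he, pow_zero, mul_one]
    exact hunits η
  -- Obtained by differentiating `u = η ϖ ^ e` and solving for `D ϖ`; dividing by `e` is possible in
  -- characteristic zero. The factor `ϖ` in front of `D η` makes `D ϖ` have one pole fewer than a
  -- general `D x`, as the denominator step requires.
  have hDϖ : D ϖ = ((m : E) + 1)⁻¹ * (((η : O) : E)⁻¹ * (ϖ * (η : O) - ϖ * D (η : O))) := by
    have h1 := hDu
    rw [hη, D.leibniz, D.leibniz_pow] at h1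
    simp only [smul_eq_mul, nsmul_eq_mul, Nat.add_sub_cancel, Nat.cast_add, Nat.cast_one] at h1
    have hm : (m : E) + 1 ≠ 0 := by exact_mod_cast Nat.succ_ne_zero m
    have hη0 := hunits0 η
    have hϖm := pow_ne_zero m hϖ0
    field_simp
    refine mul_left_cancel₀ hϖm ?_
    rw [pow_succ] at h1
    linear_combination h1
  clear hε
  induction N with
  | zero => intro x hx; simpa using hbase x hx
  | succ N ih =>
    refine ih (derivation_denominator_step O D (p := (ϖ : E)) ?_ ?_ ?_ ?_)
    · intro x hx z hz n hxz
      have hdvd : ϖ ∣ (⟨x, hx⟩ : O) ^ n := ⟨⟨z, hz⟩, Subtype.ext (by simpa using hxz)⟩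
      obtain ⟨c, hc⟩ := hϖ.prime.dvd_of_dvd_pow hdvd
      exact ⟨c, c.2, congrArg Subtype.val hc⟩
    · intro x hx
      exact exists_aeval_eq_mul_of_trdeg_le_one htr O hx ϖ.2 hϖ0
    · have hm : ((m : E) + 1)⁻¹ ∈ O := by
        have : ((m : E) + 1)⁻¹ = algebraMap K E ((m : K) + 1)⁻¹ := by simp
        rw [this]; exact O.algebraMap_mem _
      have : (ϖ : E) ^ N * D ϖ = ((m : E) + 1)⁻¹ * (((η : O) : E)⁻¹ *
          ((ϖ : E) ^ (N + 1) * (η : O) - (ϖ : E) ^ (N + 1) * D (η : O))) := by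
        rw [hDϖ]; ring
      rw [this]
      exact mul_mem hm (mul_mem (hunits η) (sub_mem (mul_mem (pow_mem ϖ.2 _) (Subtype.prop _))
        (hbase _ (Subtype.prop _))))
    · intro x hx
      rw [← pow_succ]
      exact hbase x hx

/-- A local argument at the places above `u = 0`, the only ones where `hloc` allows `D x` a pole. If
the ideal of denominators of `D x` were proper, it would lie in a maximal ideal `q`, which contains
`u`. Localizing at `q` gives a discrete valuation ring preserved by `D`, so `D x` has a denominator
outside `q`, a contradiction. -/
theorem logarithmic_derivation_isIntegral_adjoin [CharZero K] {u : E} (hu : Transcendental K u)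
    [FiniteDimensional K⟮u⟯ E] (D : Derivation K E E) (hDu : D u = u)
    (hloc : ∀ x, IsIntegral (Algebra.adjoin K {u}) x →
      ∃ m : ℕ, IsIntegral (Algebra.adjoin K {u}) (u ^ m * D x)) {x : E}
    (hx : IsIntegral (Algebra.adjoin K {u}) x) : IsIntegral (Algebra.adjoin K {u}) (D x) := by
  have hu0 : u ≠ 0 := fun h => hu (h ▸ isAlgebraic_zero)
  have := isPrincipalIdealRing_adjoin_singleton (K := K) u
  have := isAlgebraic_adjoin_of_isAlgebraic (K := K) u
  have := finite_integralClosure_adjoin (K := K) u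
  have : CharZero K⟮u⟯ := charZero_of_injective_algebraMap (algebraMap K K⟮u⟯).injective
  let S := integralClosure (Algebra.adjoin K {u}) E
  have hSD : IsDedekindDomain S := integralClosure.isDedekindDomain _ K⟮u⟯ E
  have hSF : IsFractionRing S E := integralClosure.isFractionRing_of_finite_extension K⟮u⟯ E
  have hS : ∀ y : E, IsIntegral (Algebra.adjoin K {u}) y → y ∈ S := fun y hy => hy
  have huS : u ∈ S := isIntegral_algebraMap
    (x := (⟨u, Algebra.self_mem_adjoin_singleton K u⟩ : Algebra.adjoin K {u}))
  obtain ⟨d, hd, hd0, hdD⟩ := exists_mul_derivation_isIntegral (Algebra.adjoin K {u}) D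
    (derivation_mem_adjoin_singleton D (by rw [hDu]; exact Algebra.self_mem_adjoin_singleton K u))
  have hdS : d ∈ S := isIntegral_algebraMap (x := (⟨d, hd⟩ : Algebra.adjoin K {u}))
  -- The ideal of denominators of `D x`.
  let I : Ideal S :=
    { carrier := {s | (s : E) * D x ∈ S}
      add_mem' := fun {a b} ha hb => by
        simp only [Set.mem_ofPred_eq, Subalgebra.coe_add, add_mul] at *
        exact add_mem ha hb
      zero_mem' := by simp
      smul_mem' := fun c a ha => by
        simp only [Set.mem_ofPred_eq, smul_eq_mul, Subalgebra.coe_mul, mul_assoc] at *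
        exact mul_mem c.2 ha }
  have hI : ∀ s : S, s ∈ I ↔ (s : E) * D x ∈ S := fun s => Iff.rfl
  by_cases hItop : I = ⊤
  · have := (hI 1).mp (hItop ▸ Submodule.mem_top)
    rw [Subalgebra.coe_one, one_mul] at this
    exact this
  exfalso
  obtain ⟨q, hq, hIq⟩ := I.exists_le_maximal hItop
  have huq : (⟨u, huS⟩ : S) ∈ q := by
    obtain ⟨m, hm⟩ := hloc x hx
    exact hq.isPrime.mem_of_pow_mem m (hIq ((hI _).mpr (by simpa using hS _ hm)))
  have hqbot : q ≠ ⊥ := fun h => by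
    rw [h, Ideal.mem_bot] at huq
    exact hu0 (congrArg Subtype.val huq)
  let O' := Localization.subalgebra.ofField E q.primeCompl q.primeCompl_le_nonZeroDivisors
  let O : Subalgebra K E := O'.restrictScalars K
  have : IsDiscreteValuationRing O :=
    IsLocalization.AtPrime.isDiscreteValuationRing_of_dedekind_domain S hqbot O'
  have hO : ∀ y, y ∈ O ↔ ∃ (a s : S) (_ : s ∈ q.primeCompl), y = a * (s : E)⁻¹ := fun y => Iff.rfl
  have hSO : ∀ y ∈ S, y ∈ O := fun y hy => O'.algebraMap_mem ⟨y, hy⟩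
  have hOinv : ∀ s ∈ q.primeCompl, (s : E)⁻¹ ∈ O := fun s hs => (hO _).mpr ⟨1, s, hs, by simp⟩
  have hne : ∀ s ∈ q.primeCompl, (s : E) ≠ 0 := fun s hs h =>
    hs (by rw [show s = 0 from Subtype.ext h]; exact q.zero_mem)
  have hunit : u⁻¹ ∉ O := by
    intro h
    obtain ⟨a, s, hs, has⟩ := (hO _).mp h
    refine hs ?_
    have h1 : s = ⟨u, huS⟩ * a := Subtype.ext (by
      have := hne s hs
      field_simp at has
      simpa using has)
    rw [h1]
    exact q.mul_mem_right _ huq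
  have hbound : ∀ y ∈ O, d * D y ∈ O := by
    intro y hy
    obtain ⟨a, s, hs, rfl⟩ := (hO _).mp hy
    have h1 : d * D (a * (s : E)⁻¹) =
        (s : E)⁻¹ * (d * D a) - a * ((s : E)⁻¹ * ((s : E)⁻¹ * (d * D s))) := by
      rw [D.leibniz, D.leibniz_inv]
      have := hne s hs
      simp only [smul_eq_mul]
      field_simp
      ring
    rw [h1]
    exact sub_mem (mul_mem (hOinv s hs) (hSO _ (hdD _ a.2)))
      (mul_mem (hSO _ a.2) (mul_mem (hOinv s hs) (mul_mem (hOinv s hs) (hSO _ (hdD _ s.2)))))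
  obtain ⟨a, s, hs, has⟩ := (hO _).mp (derivation_mem_of_isDiscreteValuationRing
    (trdeg_le_one_of_isAlgebraic u) O D (hSO u huS) hu0 hunit hDu ⟨d, hSO d hdS, hd0, hbound⟩ x
    (hSO x hx))
  refine hs (hIq ((hI s).mpr ?_))
  rw [has, mul_left_comm, mul_inv_cancel₀ (hne s hs), mul_one]
  exact a.2

theorem exists_derivative_eq [CharZero K] (f : K[X]) : ∃ g : K[X], derivative g = f := by
  induction f using Polynomial.induction_on' with
  | add p q hp hq =>
    obtain ⟨p', rfl⟩ := hp
    obtain ⟨q', rfl⟩ := hq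
    exact ⟨p' + q', derivative_add⟩
  | monomial n a =>
    refine ⟨monomial (n + 1) (a / (n + 1)), ?_⟩
    have : (n : K) + 1 ≠ 0 := by exact_mod_cast Nat.succ_ne_zero n
    rw [derivative_monomial, Nat.add_sub_cancel]
    congr 1
    push_cast
    field_simp

/-- The affine line over a field of characteristic zero has no finite unramified covers except those
coming from extensions of the base field. -/
theorem exists_ramified_of_adjoin_ne_top [CharZero K] {t : E} (ht : Transcendental K t)
    [FiniteDimensional K⟮t⟯ E] (hK : ∀ x : E, IsIntegral K x → x ∈ (algebraMap K E).range)
    (hne : K⟮t⟯ ≠ ⊤) :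
    ∃ p : K[X], Irreducible p ∧ ∃ x z : E, IsIntegral (Algebra.adjoin K {t}) x ∧
      IsIntegral (Algebra.adjoin K {t}) z ∧ (∃ n : ℕ, x ^ n = aeval t p * z) ∧
      ¬ IsIntegral (Algebra.adjoin K {t}) (x / aeval t p) := by
  by_contra! hcon
  have ht0 : t ≠ 0 := fun h => ht (h ▸ isAlgebraic_zero)
  have hchar : CharZero E := charZero_of_injective_algebraMap (algebraMap K E).injective
  obtain ⟨D, hDt⟩ := exists_derivation_apply_eq_one ht
  have htr := trdeg_le_one_of_isAlgebraic (K := K) t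
  have hKu : K⟮t⁻¹⟯ = K⟮t⟯ := by
    apply le_antisymm
    · exact adjoin_simple_le_iff.mpr (inv_mem (mem_adjoin_simple_self K t))
    · exact adjoin_simple_le_iff.mpr (by simpa using inv_mem (mem_adjoin_simple_self K t⁻¹))
  have hfin : FiniteDimensional K⟮t⁻¹⟯ E := by rw [hKu]; infer_instance
  have hu : Transcendental K t⁻¹ := fun h => ht (by simpa using h.inv)
  have hD : ∀ x, IsIntegral (Algebra.adjoin K {t}) x → IsIntegral (Algebra.adjoin K {t}) (D x) :=
    fun x hx => derivation_isIntegral_adjoin ht D hDt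
      (fun p hp x z hx hz n hn => hcon p hp x z hx hz ⟨n, hn⟩) hx
  have htint : IsIntegral (Algebra.adjoin K {t}) t := isIntegral_algebraMap
    (x := (⟨t, Algebra.self_mem_adjoin_singleton K t⟩ : Algebra.adjoin K {t}))
  have huint : IsIntegral (Algebra.adjoin K {t⁻¹}) t⁻¹ := isIntegral_algebraMap
    (x := (⟨t⁻¹, Algebra.self_mem_adjoin_singleton K t⁻¹⟩ : Algebra.adjoin K {t⁻¹}))
  have hnat : ∀ (R : Subalgebra K E) (n : ℕ), IsIntegral R (n : E) := fun R n =>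
    (map_natCast (algebraMap R E) n) ▸ isIntegral_algebraMap
  -- The derivation `-t D` is logarithmic at infinity: it sends `u = t⁻¹` to itself. Away from `u =
  -- 0` it introduces no poles because `D` preserves integrality over `K[t]`; this is checked by
  -- moving `y` into that ring with a power of `t`.
  have hδ : ∀ x, IsIntegral (Algebra.adjoin K {t⁻¹}) x →
      IsIntegral (Algebra.adjoin K {t⁻¹}) (-t * D x) := by
    intro x hx
    refine logarithmic_derivation_isIntegral_adjoin hu ((-t) • D) ?_ (fun y hy => ?_) hx
    · simp [D.leibniz_inv, hDt]
      field_simp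
    · obtain ⟨n, hn⟩ := exists_pow_inv_mul_isIntegral_adjoin_inv (inv_ne_zero ht0) hy
      rw [inv_inv] at hn
      have h1 := (htint.mul (hD _ hn)).sub ((hnat _ n).mul hn)
      obtain ⟨m, hm⟩ := exists_pow_inv_mul_isIntegral_adjoin_inv ht0 h1
      refine ⟨m + n, ?_⟩
      have h2 : t * D (t ^ n * y) - n * (t ^ n * y) = t ^ n * (t * D y) := by
        rw [D.leibniz, D.leibniz_pow, hDt]
        simp only [smul_eq_mul, nsmul_eq_mul, mul_one]
        rcases n with _ | n
        · simp
        · simp only [Nat.add_sub_cancel]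
          ring
      rw [h2] at hm
      have h3 : t⁻¹ ^ (m + n) * ((-t) • D) y =
          -(t⁻¹ ^ n * t⁻¹ ^ n * (t⁻¹ ^ m * (t ^ n * (t * D y)))) := by
        have h4 : t⁻¹ ^ n * t ^ n = 1 := by rw [← mul_pow, inv_mul_cancel₀ ht0, one_pow]
        simp only [Derivation.smul_apply, smul_eq_mul, pow_add]
        linear_combination t⁻¹ ^ n * t⁻¹ ^ m * t * D y * h4
      rw [h3]
      exact (((huint.pow n).mul (huint.pow n)).mul hm).neg
  -- Induction on the bound `n` for the poles at infinity. Without poles, `b` is constant, hence in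
  -- `K`. Otherwise `D b` satisfies the bound `n - 1`, so it is a polynomial; subtracting a
  -- primitive of it from `b` leaves an element killed by `D`, again a constant.
  have hpoly : ∀ n : ℕ, ∀ b, IsIntegral (Algebra.adjoin K {t}) b →
      IsIntegral (Algebra.adjoin K {t⁻¹}) (t⁻¹ ^ n * b) → b ∈ Algebra.adjoin K {t} := by
    intro n
    induction n with
    | zero =>
      intro b hb hb'
      obtain ⟨c, rfl⟩ := hK b (isIntegral_of_isIntegral_adjoin_inv hb (by simpa using hb'))
      exact Subalgebra.algebraMap_mem _ c
    | succ n ih =>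
      intro b hb hb'
      have h1 : t⁻¹ ^ n * D b = (n + 1) * (t⁻¹ ^ (n + 1) * b) - (-t * D (t⁻¹ ^ (n + 1) * b)) := by
        rw [D.leibniz, D.leibniz_pow, D.leibniz_inv, hDt]
        simp only [smul_eq_mul, nsmul_eq_mul, Nat.add_sub_cancel, Nat.cast_add, Nat.cast_one]
        have h3 : t * t⁻¹ = 1 := mul_inv_cancel₀ ht0
        linear_combination (-(t⁻¹ ^ n * D b) + (n + 1) * t⁻¹ ^ (n + 1) * b) * h3
      have h2 : D b ∈ Algebra.adjoin K {t} := by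
        refine ih (D b) (hD b hb) ?_
        rw [h1]
        refine IsIntegral.sub (IsIntegral.mul ?_ hb') (hδ _ hb')
        exact_mod_cast hnat _ (n + 1)
      rw [Algebra.adjoin_singleton_eq_range_aeval] at h2
      obtain ⟨f, hf⟩ := h2
      obtain ⟨g, rfl⟩ := exists_derivative_eq f
      have hDbg : D (b - aeval t g) = 0 := by
        rw [map_sub, D.map_aeval, hDt, ← hf, smul_eq_mul, mul_one]
        exact sub_self _
      obtain ⟨c, hc⟩ := hK _ (isAlgebraic_of_derivation_eq_zero htr D (t := t) (by simp [hDt])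
        hDbg).isIntegral
      have : b = algebraMap K E c + aeval t g := by rw [hc]; ring
      rw [this, Algebra.adjoin_singleton_eq_range_aeval]
      exact add_mem (Subalgebra.algebraMap_mem _ c) ⟨g, rfl⟩
  apply hne
  rw [eq_top_iff]
  intro x _
  have := isAlgebraic_adjoin_of_isAlgebraic (K := K) t
  obtain ⟨d, hd0, hd⟩ :=
    (Algebra.IsAlgebraic.isAlgebraic (R := Algebra.adjoin K {t}) x).exists_integral_multiple
  obtain ⟨n, hn⟩ := exists_pow_inv_mul_isIntegral_adjoin_inv ht0 hd
  have hle := algebra_adjoin_le_adjoin K ({t} : Set E)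
  have h1 : (d : E) * x ∈ K⟮t⟯ := hle (hpoly n _ hd hn)
  have h2 : x = (d : E)⁻¹ * (d * x) := by
    have : (d : E) ≠ 0 := fun h => hd0 (Subtype.ext h)
    field_simp
  rw [h2]
  exact mul_mem (inv_mem (hle d.2)) h1

end HilbertProperty

end

/-! ### Étale algebras and radical ideals -/

noncomputable section

namespace HilbertProperty

section Etale

open scoped TensorProduct

/-- By flatness `S` embeds into its base change to the fraction field, and an étale algebra over a
field is reduced. -/
theorem isReduced_of_etale (R S : Type*) [CommRing R] [IsDomain R] [CommRing S] [Algebra R S]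
    [Algebra.Etale R S] : IsReduced S := by
  have : IsReduced (FractionRing R ⊗[R] S) :=
    Algebra.FormallyUnramified.isReduced_of_field (FractionRing R) _
  exact isReduced_of_injective (Algebra.TensorProduct.includeRight : S →ₐ[R] FractionRing R ⊗[R] S)
    (Algebra.TensorProduct.includeRight_injective (IsFractionRing.injective R (FractionRing R)))

theorem mem_map_of_pow_mem_of_etale {R S : Type*} [CommRing R] [CommRing S] [Algebra R S]
    [Algebra.Etale R S] (I : Ideal R) [I.IsPrime] {x : S} {n : ℕ}
    (hx : x ^ n ∈ I.map (algebraMap R S)) : x ∈ I.map (algebraMap R S) := by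
  have := isReduced_of_etale (R ⧸ I) ((R ⧸ I) ⊗[R] S)
  have : IsReduced (S ⧸ I.map (algebraMap R S)) := isReduced_of_injective
    (Algebra.TensorProduct.quotIdealMapEquivQuotTensor S I)
    (Algebra.TensorProduct.quotIdealMapEquivQuotTensor S I).injective
  rw [← Ideal.Quotient.eq_zero_iff_mem] at hx ⊢
  rw [map_pow] at hx
  exact eq_zero_of_pow_eq_zero hx

/-- Generic étaleness: the extension of fraction fields is separable in characteristic zero, so `A`
is étale over `R` at its generic point and hence on some basic open set of an `f ∈ A`. As `f` is
algebraic over `R`, it divides a nonzero element of `R`. -/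
theorem exists_etale_localization_away (R A : Type*) [CommRing R] [IsDomain R] [IsNoetherianRing R]
    [CharZero R] [CommRing A] [IsDomain A] [Algebra R A] [FaithfulSMul R A] [Module.Finite R A] :
    ∃ h : R, h ≠ 0 ∧ Algebra.Etale R (Localization.Away (algebraMap R A h)) := by
  have : Algebra.FinitePresentation R A := Algebra.FinitePresentation.of_finiteType.mp inferInstance
  have hchar : CharZero (FractionRing R) :=
    charZero_of_injective_algebraMap (IsFractionRing.injective R (FractionRing R))
  have hloc : IsFractionRing A (Localization.AtPrime (⊥ : Ideal A)) :=
    by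
      have : (⊥ : Ideal A).primeCompl = nonZeroDivisors A := by
        ext; simp [Ideal.primeCompl]
      unfold IsFractionRing
      rw [← this]
      infer_instance
  let : Field (Localization.AtPrime (⊥ : Ideal A)) := IsFractionRing.toField A
  have : FaithfulSMul R (Localization.AtPrime (⊥ : Ideal A)) := by
    rw [faithfulSMul_iff_algebraMap_injective, IsScalarTower.algebraMap_eq R A]
    exact (IsFractionRing.injective A _).comp (FaithfulSMul.algebraMap_injective R A)
  let : Algebra (FractionRing R) (Localization.AtPrime (⊥ : Ideal A)) :=
    FractionRing.liftAlgebra R _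
  have : Algebra.IsAlgebraic R (Localization.AtPrime (⊥ : Ideal A)) := by
    have := IsLocalization.isAlgebraic (Localization.AtPrime (⊥ : Ideal A)) (nonZeroDivisors A)
    exact Algebra.IsAlgebraic.trans R A _
  have : Algebra.IsAlgebraic (FractionRing R) (Localization.AtPrime (⊥ : Ideal A)) :=
    Algebra.IsAlgebraic.extendScalars (R := R) (IsFractionRing.injective R (FractionRing R))
  have : Algebra.FormallyEtale R (FractionRing R) :=
    Algebra.FormallyEtale.of_isLocalization (nonZeroDivisors R)
  have : Algebra.FormallyEtale (FractionRing R) (Localization.AtPrime (⊥ : Ideal A)) :=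
    Algebra.FormallyEtale.of_isSeparable _ _
  have : Algebra.IsEtaleAt R (⊥ : Ideal A) := Algebra.FormallyEtale.comp R (FractionRing R) _
  obtain ⟨f, hf, hfe⟩ := Algebra.exists_etale_of_isEtaleAt (R := R) (⊥ : Ideal A)
  obtain ⟨h, hh, g, hg⟩ := (Algebra.IsAlgebraic.isAlgebraic (R := R) f).exists_nonzero_dvd
    (mem_nonZeroDivisors_of_ne_zero fun h0 => hf (h0 ▸ Submodule.zero_mem _))
  refine ⟨h, hh, Algebra.basicOpen_subset_etaleLocus_iff_etale.mp
    (subset_trans ?_ (Algebra.basicOpen_subset_etaleLocus_iff_etale.mpr hfe))⟩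
  rw [hg]
  exact PrimeSpectrum.basicOpen_mul_le_left f g

-- After inverting `h`, the composite `R → A → C` is étale, so the prime `q` generates a radical
-- ideal there. Clearing denominators costs a power of `h`.
attribute [local instance] Algebra.TensorProduct.rightAlgebra in
theorem exists_pow_mul_eq_of_etale {R A C : Type*} [CommRing R] [CommRing A] [CommRing C]
    [IsDomain C] [Algebra R A] [Algebra A C] [Algebra R C] [IsScalarTower R A C] [FaithfulSMul R C]
    {h q : R} (hh : h ≠ 0) [Algebra.Etale R (Localization.Away (algebraMap R A h))]
    [Algebra.Etale A C] (hq : Prime q) {x z : C} {n : ℕ} (hx : x ^ n = algebraMap R C q * z) :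
    ∃ (m : ℕ) (w : C), algebraMap R C h ^ m * x = algebraMap R C q * w := by
  let T := Localization.Away (algebraMap R A h) ⊗[A] C
  have : Algebra.Etale R T := Algebra.Etale.comp R (Localization.Away (algebraMap R A h)) T
  have hloc : IsLocalization (Algebra.algebraMapSubmonoid C
    (Submonoid.powers (algebraMap R A h))) T := inferInstance
  have : IsScalarTower A C T := inferInstance
  have : IsScalarTower R C T := IsScalarTower.of_algebraMap_eq' (by
    rw [IsScalarTower.algebraMap_eq R A C, ← RingHom.comp_assoc, ← IsScalarTower.algebraMap_eq A C T,
      ← IsScalarTower.algebraMap_eq R A T])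
  have hprime : (Ideal.span {q}).IsPrime := (Ideal.span_singleton_prime hq.ne_zero).mpr hq
  have h1 : algebraMap C T x ∈ (Ideal.span {q}).map (algebraMap R T) := by
    refine mem_map_of_pow_mem_of_etale _ (n := n) ?_
    rw [← map_pow, hx, map_mul, ← IsScalarTower.algebraMap_apply R C T]
    exact Ideal.mul_mem_right _ _ (Ideal.mem_map_of_mem _ (Ideal.mem_span_singleton_self q))
  rw [Ideal.map_span, Set.image_singleton, Ideal.mem_span_singleton] at h1
  obtain ⟨w, hw⟩ := h1
  obtain ⟨⟨w, ⟨_, ⟨_, ⟨m, rfl⟩, rfl⟩⟩⟩, hwT⟩ := IsLocalization.surj (Algebra.algebraMapSubmonoid C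
    (Submonoid.powers (algebraMap R A h))) w
  refine ⟨m, w, ?_⟩
  have hinj : Function.Injective (algebraMap C T) := by
    refine IsLocalization.injective T (M := Algebra.algebraMapSubmonoid C
      (Submonoid.powers (algebraMap R A h))) ?_
    rintro _ ⟨_, ⟨k, rfl⟩, rfl⟩
    refine mem_nonZeroDivisors_of_ne_zero ?_
    rw [map_pow, ← IsScalarTower.algebraMap_apply]
    exact pow_ne_zero _ fun h0 => hh (FaithfulSMul.algebraMap_injective R C (by simpa using h0))
  apply hinj
  simp only [map_mul, map_pow, ← IsScalarTower.algebraMap_apply] at hwT ⊢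
  rw [hw, ← hwT]
  ring

end Etale

/-! ### Choice of a parameter on an affine variety -/

section

attribute [local instance] MvPolynomial.algebraMvPolynomial in
/-- If a polynomial multiple of an algebraic element is integral, then so are the multiples by
the coefficients. -/
theorem isIntegral_coeff_mul_of_isIntegral {R M σ : Type*} [CommRing R] [IsDomain R] [Field M]
    [Algebra R M] {s : σ → M} (hs : AlgebraicIndependent R s) (h : MvPolynomial σ R) {y : M}
    (hy : IsAlgebraic R y)
    (hint : (MvPolynomial.aeval (R := R) s).toRingHom.IsIntegralElem (MvPolynomial.aeval s h * y))
    (α : σ →₀ ℕ) : IsIntegral R (algebraMap R M (h.coeff α) * y) := by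
  -- The family `s` stays algebraically independent over `L`, which contains `y`. So `y · h(s)` is
  -- the value of a genuine polynomial over `L`, and a polynomial over `L` is integral over `R[s]`
  -- exactly when its coefficients are integral over `R`.
  let L := Subalgebra.algebraicClosure R M
  have hsL : AlgebraicIndependent L s := hs.extendScalars L
  let y' : L := ⟨y, hy⟩
  let H : MvPolynomial σ L := MvPolynomial.C y' * MvPolynomial.map (algebraMap R L) h
  obtain ⟨P, hP, hPe⟩ := hint
  have hH : IsIntegral (MvPolynomial σ R) H := by
    refine ⟨P, hP, ?_⟩
    apply hsL
    have hcomp : ((MvPolynomial.aeval (R := L) s : MvPolynomial σ L →ₐ[L] M) : _ →+* M).comp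
        (algebraMap (MvPolynomial σ R) (MvPolynomial σ L)) =
        (MvPolynomial.aeval (R := R) s).toRingHom := by
      refine RingHom.ext fun g => ?_
      change MvPolynomial.aeval s (MvPolynomial.map (algebraMap R L) g) = MvPolynomial.aeval s g
      exact MvPolynomial.aeval_map_algebraMap L s g
    have hHe : MvPolynomial.aeval (R := L) s H = MvPolynomial.aeval s h * y := by
      simp [H, y', mul_comm, MvPolynomial.aeval_map_algebraMap]
    rw [map_zero, ← hPe, ← hHe, ← hcomp]
    exact Polynomial.hom_eval₂ P _
      ((MvPolynomial.aeval (R := L) s : MvPolynomial σ L →ₐ[L] M) : _ →+* M) H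
  have := (MvPolynomial.isIntegral_iff_isIntegral_coeff.mp hH α).map
    (IsScalarTower.toAlgHom R L M)
  rw [MvPolynomial.coeff_C_mul, MvPolynomial.coeff_map, map_mul, mul_comm] at this
  exact this

end

end HilbertProperty

end

noncomputable section

namespace HilbertProperty

open Polynomial

theorem isIntegral_of_range_le {R S M : Type*} [CommRing R] [CommRing S] [CommRing M] [Nontrivial M]
    {f : R →+* M} {g : S →+* M} (hfg : ∀ r, f r ∈ g.range) {x : M} (hx : f.IsIntegralElem x) :
    g.IsIntegralElem x := by
  obtain ⟨p, hp, hpx⟩ := hx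
  obtain ⟨q, hq, -, hqm⟩ := lifts_and_natDegree_eq_and_monic (p := p.map f) (f := g)
    ((lifts_iff_coeff_lifts _).mpr fun n => by rw [coeff_map]; exact hfg _) (hp.map _)
  exact ⟨q, hqm, by rw [← Polynomial.eval_map, hq, Polynomial.eval_map]; exact hpx⟩

/-- A common root `γ = α + b`, with `α` a root of `P`, forces `b` to be one of finitely many
differences `γ - α`. -/
theorem exists_isCoprime_comp_X_sub_C {K : Type*} [Field K] [Infinite K] {P c : K[X]} (hP : P ≠ 0)
    (hc : c ≠ 0) : ∃ b : K, IsCoprime (P.comp (X - C b)) c := by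
  classical
  let Ω := AlgebraicClosure K
  let S : Finset Ω := (P.aroots Ω).toFinset.image₂ (fun α γ => γ - α) (c.aroots Ω).toFinset
  obtain ⟨b, hb⟩ := ((S.finite_toSet.preimage
    ((algebraMap K Ω).injective.injOn)).infinite_compl).nonempty
  refine ⟨b, (isCoprime_iff_aeval_ne_zero_of_isAlgClosed K Ω _ _).mpr fun a => ?_⟩
  by_contra! h
  refine hb ?_
  rw [Set.mem_preimage, Finset.mem_coe, Finset.mem_image₂]
  refine ⟨a - algebraMap K Ω b, ?_, a, ?_, by ring⟩
  · rw [Multiset.mem_toFinset, mem_aroots]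
    refine ⟨hP, ?_⟩
    simpa [aeval_comp] using h.1
  · rw [Multiset.mem_toFinset, mem_aroots]
    exact ⟨hc, h.2⟩

/-- Noether normalization with one variable singled out; there is at least one variable because `A`
is not integral over `K`. -/
theorem exists_finite_injective_mvPolynomial_polynomial {K A : Type*} [Field K] [CommRing A]
    [Nontrivial A] [Algebra K A] [Algebra.FiniteType K A] (hA : ¬ Algebra.IsIntegral K A) :
    ∃ (n : ℕ) (g : MvPolynomial (Fin n) K[X] →ₐ[K] A), Function.Injective g ∧ g.Finite := by
  obtain ⟨s, g, hg, hgf⟩ := exists_finite_inj_algHom_of_fg K A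
  rcases s with _ | n
  · refine absurd ⟨fun a => ?_⟩ hA
    refine isIntegral_of_range_le (f := g.toRingHom) (fun r => ?_) (hgf.to_isIntegral a)
    rw [MvPolynomial.eq_C_of_isEmpty r]
    exact ⟨_, (g.commutes _).symm⟩
  · let e : MvPolynomial (Fin n) K[X] ≃ₐ[K] MvPolynomial (Fin (n + 1)) K :=
      (MvPolynomial.optionEquivRight K (Fin n)).symm.trans
        (MvPolynomial.renameEquiv K (finSuccEquiv n).symm)
    refine ⟨n, g.comp e.toAlgHom, hg.comp e.injective, ?_⟩
    exact RingHom.Finite.comp hgf (RingHom.Finite.of_surjective _ e.surjective)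

/-- The conclusion says that an étale integral closure of `A` in `M` forces the integral closure of
`K[φ]` in `M` to be reduced modulo each irreducible `p ∣ P`. Let `A` be finite over `R = K[t][x₁, …,
xₙ]` and étale outside `h = 0`, and take `φ = t - b` with `b` generic, so that `q = p(t - b)` does
not divide `h`. If `x ^ n = q z`, then `h ^ m x ∈ q C` for the étale algebra `C`, so `h ^ m (x / q)`
is integral over `R`. Comparing coefficients in the `xᵢ` removes `h`. The choice of `φ` depends on
`A` and `P` only, so it serves all covers at once. -/
theorem exists_parameter {K A : Type u} [Field K] [CharZero K] [CommRing A] [IsDomain A]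
    [Algebra K A] [Algebra.FiniteType K A] (hA : ¬ Algebra.IsIntegral K A) {P : K[X]} (hP : P ≠ 0) :
    ∃ φ : A, Transcendental K φ ∧ ∀ (M : Type u) [Field M] [Algebra A M] [Algebra K M]
      [IsScalarTower K A M] [FaithfulSMul A M], Algebra.Etale A (integralClosure A M) →
      ∀ p : K[X], Irreducible p → p ∣ P → ∀ x z : M,
      IsIntegral (Algebra.adjoin K {algebraMap A M φ}) x →
      IsIntegral (Algebra.adjoin K {algebraMap A M φ}) z →
      (∃ n : ℕ, x ^ n = aeval (algebraMap A M φ) p * z) →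
      IsIntegral (Algebra.adjoin K {algebraMap A M φ}) (x / aeval (algebraMap A M φ) p) := by
  obtain ⟨n, g, hg, hgf⟩ := exists_finite_injective_mvPolynomial_polynomial hA
  let R := MvPolynomial (Fin n) K[X]
  let : Algebra R A := g.toRingHom.toAlgebra
  have hRA : ∀ r, algebraMap R A r = g r := fun _ => rfl
  have : FaithfulSMul R A := (faithfulSMul_iff_algebraMap_injective R A).mpr hg
  have : Module.Finite R A := hgf
  obtain ⟨h, hh, hhe⟩ := exists_etale_localization_away R A
  -- One nonzero coefficient of `h`, coprime to the translate of `P`, is enough to keep every `q`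
  -- from dividing `h`.
  obtain ⟨α, hα⟩ := MvPolynomial.ne_zero_iff.mp hh
  obtain ⟨b, hb⟩ := exists_isCoprime_comp_X_sub_C hP hα
  let ι : K[X] →ₐ[K] R := (Algebra.ofId K[X] R).restrictScalars K
  have hι : ∀ f, ι f = MvPolynomial.C f := fun _ => rfl
  let φ : A := g (ι (X - C b))
  have hφ : ∀ p : K[X], aeval φ p = g (ι (p.comp (X - C b))) := fun p => by
    rw [← AlgHom.comp_apply g, comp_eq_aeval, ← aeval_algHom_apply (g.comp ι)]
    rfl
  have hφt : ∀ p : K[X], p ≠ 0 → p.comp (X - C b) ≠ 0 := fun p hp h0 => hp (by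
    have := congrArg (fun f => f.comp (X + C b)) h0
    simpa [comp_assoc] using this)
  have hιinj : Function.Injective ι := MvPolynomial.C_injective _ _
  refine ⟨φ, transcendental_iff.mpr fun p hp => ?_, ?_⟩
  · by_contra hp0
    rw [hφ] at hp
    exact hφt p hp0 (hιinj (hg (by simpa using hp)))
  intro M _ _ _ _ _ het p hp hpP x z hx hz ⟨k, hk⟩
  set q := p.comp (X - C b) with hq
  have hqirr : Irreducible q := by
    have : q = algEquivAevalXAddC (-b) p := by
      rw [hq, algEquivAevalXAddC_apply, comp_eq_aeval, map_neg, sub_eq_add_neg]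
    rw [this]
    exact (MulEquiv.irreducible_iff (algEquivAevalXAddC (-b)).toMulEquiv).mpr hp
  have hqP : q ∣ P.comp (X - C b) := by
    obtain ⟨p', rfl⟩ := hpP
    exact ⟨p'.comp (X - C b), mul_comp _ _ _⟩
  have hqh : ¬ ι q ∣ h := fun hdvd =>
    hqirr.not_isUnit ((hb.of_isCoprime_of_dvd_left hqP).isUnit_of_dvd' dvd_rfl
      (MvPolynomial.C_dvd_iff_dvd_coeff _ _ |>.mp hdvd α))
  have hqprime : Prime (ι q) := (MvPolynomial.prime_C_iff (R := K[X]) _).mpr hqirr.prime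
  let : Algebra R M := ((algebraMap A M).comp (algebraMap R A)).toAlgebra
  have : IsScalarTower R A M := IsScalarTower.of_algebraMap_eq fun _ => rfl
  have : FaithfulSMul R M := (faithfulSMul_iff_algebraMap_injective R M).mpr
    ((FaithfulSMul.algebraMap_injective A M).comp hg)
  let : Algebra K[X] M := ((algebraMap R M).comp (algebraMap K[X] R)).toAlgebra
  have : IsScalarTower K[X] R M := IsScalarTower.of_algebraMap_eq fun _ => rfl
  have hqM : ∀ p : K[X], aeval (algebraMap A M φ) p = algebraMap K[X] M (p.comp (X - C b)) :=
    fun p => by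
      rw [aeval_algebraMap_apply, hφ]; rfl
  have hrange : ∀ y : M, y ∈ Algebra.adjoin K {algebraMap A M φ} ↔ y ∈ (algebraMap K[X] M).range := by
    intro y
    rw [Algebra.adjoin_singleton_eq_range_aeval]
    constructor
    · rintro ⟨f, rfl⟩
      exact ⟨_, (hqM f).symm⟩
    · rintro ⟨f, rfl⟩
      refine ⟨f.comp (X + C b), (hqM _).trans ?_⟩
      rw [comp_assoc]
      simp
  have hto : ∀ y : M, IsIntegral (Algebra.adjoin K {algebraMap A M φ}) y ↔ IsIntegral K[X] y :=
    fun y => ⟨isIntegral_of_range_le fun r => (hrange _).mp r.2,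
      isIntegral_of_range_le fun r => ⟨⟨_, (hrange _).mpr ⟨r, rfl⟩⟩, rfl⟩⟩
  rw [hto] at hx hz ⊢
  have hA : ∀ y : M, IsIntegral K[X] y → IsIntegral A y := fun y hy =>
    (hy.tower_top (A := R)).tower_top
  let C' := integralClosure A M
  have hC' : FaithfulSMul R C' := (faithfulSMul_iff_algebraMap_injective R C').mpr fun r r' hr =>
    FaithfulSMul.algebraMap_injective R M (congrArg (algebraMap C' M) hr)
  obtain ⟨m, w, hw⟩ := exists_pow_mul_eq_of_etale (A := A) (C := C') hh hqprime
    (x := ⟨x, hA x hx⟩) (z := ⟨z, hA z hz⟩) (n := k) (Subtype.ext (by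
      rw [hqM] at hk
      exact hk))
  replace hw : algebraMap R M h ^ m * x = algebraMap K[X] M q * w := congrArg Subtype.val hw
  rw [hqM, ← hq]
  have hqM0 : algebraMap K[X] M q ≠ 0 := fun h0 => hqirr.ne_zero (hιinj
    (FaithfulSMul.algebraMap_injective R M (h0.trans (by simp))))
  let s : Fin n → M := fun i => algebraMap R M (MvPolynomial.X i)
  have hs : MvPolynomial.aeval (R := K[X]) s = IsScalarTower.toAlgHom K[X] R M := by
    ext i
    rw [MvPolynomial.aeval_X]
    rfl
  have hind : AlgebraicIndependent K[X] s := by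
    change Function.Injective (MvPolynomial.aeval (R := K[X]) s)
    rw [hs]
    exact FaithfulSMul.algebraMap_injective R M
  set y := x / algebraMap K[X] M q with hy
  have hyx : algebraMap K[X] M q * y = x := by rw [hy]; field_simp
  have hKM : FaithfulSMul K[X] M := (faithfulSMul_iff_algebraMap_injective K[X] M).mpr
    ((FaithfulSMul.algebraMap_injective R M).comp hιinj)
  have hyalg : IsAlgebraic K[X] y := by
    rw [hy, div_eq_mul_inv]
    exact hx.isAlgebraic.mul (isAlgebraic_algebraMap q).inv
  have hyw : MvPolynomial.aeval (R := K[X]) s (h ^ m) * y = w := by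
    rw [hs]
    apply mul_left_cancel₀ hqM0
    rw [← hw, ← hyx, IsScalarTower.coe_toAlgHom', map_pow]
    ring
  have hint := isIntegral_coeff_mul_of_isIntegral hind (h ^ m) hyalg (by
    rw [hyw, hs]
    have : IsIntegral R (w : M) := isIntegral_trans (A := A) _ w.2
    exact this)
  -- Both `q y = x` and the product of `y` with this coefficient are integral over `K[t]`. Since the
  -- coefficient is coprime to `q`, a Bézout relation makes `y` itself integral.
  obtain ⟨β, hβ⟩ : ∃ β, ¬ q ∣ (h ^ m).coeff β := by
    by_contra! hall
    exact hqh (hqprime.dvd_of_dvd_pow ((MvPolynomial.C_dvd_iff_dvd_coeff _ _).mpr hall))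
  obtain ⟨u, v, huv⟩ := (hqirr.coprime_iff_not_dvd).mpr hβ
  have : y = algebraMap K[X] M u * x + algebraMap K[X] M v *
      (algebraMap K[X] M ((h ^ m).coeff β) * y) := by
    rw [← hyx]
    have := congrArg (algebraMap K[X] M) huv
    rw [map_add, map_mul, map_mul, map_one] at this
    linear_combination (-y) * this
  rw [this]
  exact (isIntegral_algebraMap.mul hx).add (isIntegral_algebraMap.mul (hint β))

end HilbertProperty

end

/-! ### Covers of the affine line: new constants or ramification -/

noncomputable section

namespace HilbertProperty

open Polynomial IntermediateField

/-- A bivariate polynomial whose function field contains new constants has rational points only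
over finitely many values of the first variable. -/
theorem eval_eq_zero_of_isIntegral_of_notMem_range {K E : Type u} [Field K] [Field E] [Algebra K E]
    {f : K[X][X]} {t y α : E}
    (hker : ∀ g : K[X][X], g.eval₂ (aeval t : K[X] →ₐ[K] E).toRingHom y = 0 → f ∣ g)
    {b : K[X][X]} {q : K[X]}
    (hα : b.eval₂ (aeval t : K[X] →ₐ[K] E).toRingHom y = aeval t q * α)
    (hint : IsIntegral K α) (hmem : α ∉ (algebraMap K E).range) {a c : K}
    (hac : f.eval₂ (evalRingHom a) c = 0) : q.eval a = 0 := by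
  by_contra hq
  set μ := minpoly K α
  let CC : K →+* K[X][X] := C.comp C
  -- This is `q ^ deg μ · μ(b / q)` with denominators cleared. It vanishes at `(t, y)`, hence is
  -- divisible by `f`; at a rational point of `f = 0` with `q(a) ≠ 0` it therefore produces a root
  -- of `μ` in `K`, which is impossible for an irreducible `μ` unless `α ∈ K`.
  let G : K[X][X] := ((μ.map CC).scaleRoots (C q)).eval b
  have key : ∀ {L : Type u} [Field L] (ψ : K[X][X] →+* L) (r : L), ψ b = ψ (C q) * r →
      ψ G = ψ (C q) ^ (μ.map CC).natDegree * μ.eval₂ (ψ.comp CC) r := by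
    intro L _ ψ r hr
    have : ψ G = ((μ.map CC).scaleRoots (C q)).eval₂ ψ (ψ b) := by
      simp only [G, ← eval₂_id (R := K[X][X]), hom_eval₂, RingHom.comp_id]
    rw [this, hr, scaleRoots_eval₂_mul, eval₂_map]
  have h1 : f ∣ G := by
    refine hker G ?_
    have := key (eval₂RingHom (aeval t : K[X] →ₐ[K] E).toRingHom y) α (by simpa using hα)
    rw [coe_eval₂RingHom] at this
    rw [this]
    have h2 : (eval₂RingHom (aeval t : K[X] →ₐ[K] E).toRingHom y).comp CC = algebraMap K E := by
      ext r
      simp [CC]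
    rw [h2, ← aeval_def, minpoly.aeval, mul_zero]
  obtain ⟨G', hG'⟩ := h1
  have h3 := key (eval₂RingHom (evalRingHom a) c) (b.eval₂ (evalRingHom a) c / q.eval a) (by
    rw [coe_eval₂RingHom, eval₂_C, coe_evalRingHom, mul_div_cancel₀ _ hq])
  rw [hG', map_mul, coe_eval₂RingHom, hac, zero_mul] at h3
  have h4 : (eval₂RingHom (evalRingHom a) c).comp CC = RingHom.id K := by
    ext r
    simp [CC]
  rw [h4, eval₂_id, eval₂_C, coe_evalRingHom] at h3
  have h5 := (mul_eq_zero.mp h3.symm).resolve_left (pow_ne_zero _ hq)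
  exact hmem (minpoly.mem_range_of_degree_eq_one K α
    (degree_eq_one_of_irreducible_of_root (minpoly.irreducible hint) h5))

section

variable {K : Type u} [Field K] (f : K[X][X])

/-- The ring `K(X)[Y] / (f)`, for a polynomial `f` in `K[X][Y]`. -/
abbrev FunctionRing : Type _ := AdjoinRoot (f.map (algebraMap K[X] (RatFunc K)))

variable {f}

theorem irreducible_map_ratFunc (hf : f.Monic) (hirr : Irreducible f) :
    Irreducible (f.map (algebraMap K[X] (RatFunc K))) :=
  (hf.irreducible_iff_irreducible_map_fraction_map).mp hirr

/-- The cases are separated by whether `K` is algebraically closed in the function field of `f`. If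
it is, the degree hypothesis makes the extension of `K(t)` nontrivial and simple connectedness of
the affine line gives a ramified point; if not, a new constant confines the rational points to
finitely many fibres. -/
theorem exists_ramified_or_finite [CharZero K] (hf : f.Monic) (hirr : Irreducible f)
    (hdeg : 2 ≤ f.natDegree) :
    (∃ q : K[X], q ≠ 0 ∧ ∀ a c : K, f.eval₂ (evalRingHom a) c = 0 → q.eval a = 0) ∨
    ∃ p : K[X], Irreducible p ∧ ∃ x z : FunctionRing f, IsIntegral K[X] x ∧ IsIntegral K[X] z ∧
      (∃ n : ℕ, x ^ n = algebraMap K[X] _ p * z) ∧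
      ∀ w, x = algebraMap K[X] _ p * w → ¬ IsIntegral K[X] w := by
  have hirr' := irreducible_map_ratFunc hf hirr
  have : Fact (Irreducible (f.map (algebraMap K[X] (RatFunc K)))) := ⟨hirr'⟩
  set E := FunctionRing f
  set t : E := algebraMap K[X] E X with ht
  let y : E := AdjoinRoot.root _
  have hinjE : Function.Injective (algebraMap K[X] E) := by
    rw [IsScalarTower.algebraMap_eq K[X] (RatFunc K) E]
    exact (algebraMap (RatFunc K) E).injective.comp (IsFractionRing.injective K[X] (RatFunc K))
  have htX : ∀ q : K[X], aeval t q = algebraMap K[X] E q := fun q => by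
    rw [ht, aeval_algebraMap_apply, aeval_X_left_apply]
  have htX' : (aeval t : K[X] →ₐ[K] E).toRingHom = algebraMap K[X] E := RingHom.ext htX
  have hmk : ∀ g : K[X][X], g.eval₂ (algebraMap K[X] E) y =
      AdjoinRoot.mk _ (g.map (algebraMap K[X] (RatFunc K))) := fun g => by
    rw [← AdjoinRoot.aeval_eq, aeval_map_algebraMap]
    rfl
  have htr : Transcendental K t := transcendental_iff.mpr fun p hp => hinjE (by
    rw [← htX, hp, map_zero])
  by_cases hK : ∀ x : E, IsIntegral K x → x ∈ (algebraMap K E).range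
  · right
    have hfield : ∀ r : RatFunc K, algebraMap (RatFunc K) E r ∈ K⟮t⟯ := fun r => by
      have hpol : ∀ q : K[X], algebraMap K[X] E q ∈ K⟮t⟯ := fun q => by
        rw [← htX]
        exact algebra_adjoin_le_adjoin K _ (aeval_mem_adjoin_singleton K t)
      obtain ⟨a, b, -, rfl⟩ := IsFractionRing.div_surjective K[X] r
      rw [map_div₀, ← IsScalarTower.algebraMap_apply, ← IsScalarTower.algebraMap_apply]
      exact div_mem (hpol a) (hpol b)
    have hfield' : ∀ x ∈ K⟮t⟯, x ∈ (algebraMap (RatFunc K) E).range := fun x hx => by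
      have hle : K⟮t⟯ ≤ (IsScalarTower.toAlgHom K (RatFunc K) E).fieldRange := by
        rw [adjoin_simple_le_iff]
        exact ⟨algebraMap K[X] (RatFunc K) X, (IsScalarTower.algebraMap_apply _ _ _ _).symm⟩
      exact hle hx
    have : FiniteDimensional K⟮t⟯ E := by
      let : Algebra (RatFunc K) K⟮t⟯ := ((algebraMap (RatFunc K) E).codRestrict _ hfield).toAlgebra
      have : IsScalarTower (RatFunc K) K⟮t⟯ E := IsScalarTower.of_algebraMap_eq fun _ => rfl
      have : Module.Finite (RatFunc K) E := (AdjoinRoot.powerBasis hirr'.ne_zero).finite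
      exact Module.Finite.of_restrictScalars_finite (RatFunc K) _ _
    have hne : K⟮t⟯ ≠ ⊤ := fun htop => by
      obtain ⟨r, hr⟩ := hfield' y (htop ▸ mem_top)
      have hroot : (f.map (algebraMap K[X] (RatFunc K))).IsRoot r := by
        apply (algebraMap (RatFunc K) E).injective
        rw [map_zero, ← eval₂_at_apply, hr]
        exact AdjoinRoot.eval₂_root _
      have := degree_eq_one_of_irreducible_of_root hirr' hroot
      rw [hf.degree_map, degree_eq_natDegree hf.ne_zero] at this
      norm_cast at this
      omega
    obtain ⟨p, hp, x, z, hx, hz, hn, hw⟩ := exists_ramified_of_adjoin_ne_top htr hK hne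
    have hrange : ∀ w : E, w ∈ Algebra.adjoin K {t} ↔ w ∈ (algebraMap K[X] E).range := fun w => by
      rw [Algebra.adjoin_singleton_eq_range_aeval, ← htX']
      rfl
    have hconv : ∀ w : E, IsIntegral K[X] w ↔ IsIntegral (Algebra.adjoin K {t}) w := fun w =>
      ⟨isIntegral_of_range_le fun r => ⟨⟨_, (hrange _).mpr ⟨r, rfl⟩⟩, rfl⟩,
        isIntegral_of_range_le fun r => (hrange _).mp r.2⟩
    refine ⟨p, hp, x, z, (hconv _).mpr hx, (hconv _).mpr hz, htX p ▸ hn, fun w hxw hw' => hw ?_⟩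
    have hp0 : algebraMap K[X] E p ≠ 0 := fun h0 => hp.ne_zero (hinjE (by rw [h0, map_zero]))
    rw [hxw, htX, mul_div_cancel_left₀ _ hp0]
    exact (hconv _).mp hw'
  · left
    push Not at hK
    obtain ⟨α, hα, hαK⟩ := hK
    obtain ⟨g, rfl⟩ := AdjoinRoot.mk_surjective α
    obtain ⟨q, hq, hqg⟩ := IsLocalization.integerNormalization_spec (nonZeroDivisors K[X]) g
    refine ⟨q, nonZeroDivisors.ne_zero hq, fun a c hac => ?_⟩
    refine eval_eq_zero_of_isIntegral_of_notMem_range (f := f) (t := t) (y := y)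
      (b := IsLocalization.integerNormalization (nonZeroDivisors K[X]) g) ?_ ?_ hα hαK hac
    · intro g hg
      rw [htX', hmk, AdjoinRoot.mk_eq_zero] at hg
      exact (Polynomial.map_dvd_map _ (IsFractionRing.injective K[X] (RatFunc K)) hf).mp hg
    · rw [htX', hmk, hqg, htX, Algebra.smul_def, map_mul]
      rfl

end

end HilbertProperty

end

/-! ### Lifting points to normalizations, and transfer of ramification -/

noncomputable section

namespace HilbertProperty

open Polynomial

theorem finite_integralClosure_of_fractionField (A F M : Type*) [CommRing A] [IsDomain A]
    [IsNoetherianRing A] [IsIntegrallyClosed A] [Field F] [CharZero F] [Algebra A F]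
    [IsFractionRing A F] [Field M] [Algebra F M] [FiniteDimensional F M] [Algebra A M]
    [IsScalarTower A F M] : Module.Finite A (integralClosure A M) :=
  IsIntegralClosure.finite A F M _

/-- Rational points of `A[Y] / (g)` outside a proper closed subset lift to the normalization. -/
theorem exists_lift_integralClosure {A F K : Type*} [CommRing A] [IsDomain A]
    [IsNoetherianRing A] [IsIntegrallyClosed A] [Field F] [CharZero F] [Algebra A F]
    [IsFractionRing A F] [Field K] {g : A[X]} (hg : g.Monic)
    (hirr : Irreducible (g.map (algebraMap A F))) :
    ∃ d : A, d ≠ 0 ∧ ∀ (x : A →+* K) (y : K), x d ≠ 0 → g.eval₂ x y = 0 →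
      ∃ x' : integralClosure A (AdjoinRoot (g.map (algebraMap A F))) →+* K,
        ∀ a, x' (algebraMap A _ a) = x a := by
  have : Fact (Irreducible (g.map (algebraMap A F))) := ⟨hirr⟩
  let M := AdjoinRoot (g.map (algebraMap A F))
  let C := integralClosure A M
  have : FiniteDimensional F M := (AdjoinRoot.powerBasis hirr.ne_zero).finite
  have := finite_integralClosure_of_fractionField A F M
  have hroot : ∀ p : A[X], p.eval₂ (Algebra.ofId A M : A →+* M)
      (AdjoinRoot.root (g.map (algebraMap A F))) = AdjoinRoot.mk _ (p.map (algebraMap A F)) :=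
    fun p => by
      rw [← AdjoinRoot.aeval_eq, aeval_map_algebraMap]
      rfl
  let j : AdjoinRoot g →ₐ[A] M := AdjoinRoot.liftAlgHom g (Algebra.ofId A M)
    (AdjoinRoot.root (g.map (algebraMap A F))) ((hroot g).trans AdjoinRoot.mk_self)
  have hjmk : ∀ p : A[X], j (AdjoinRoot.mk g p) = AdjoinRoot.mk _ (p.map (algebraMap A F)) :=
    fun p => (AdjoinRoot.liftAlgHom_mk _ _ _ _ _).trans (hroot p)
  have hj : Function.Injective j := by
    rw [injective_iff_map_eq_zero]
    intro b hb
    obtain ⟨p, rfl⟩ := AdjoinRoot.mk_surjective b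
    rw [hjmk, AdjoinRoot.mk_eq_zero,
      Polynomial.map_dvd_map _ (IsFractionRing.injective A F) hg] at hb
    exact AdjoinRoot.mk_eq_zero.mpr hb
  have hex : ∀ c : M, ∃ d : A, d ≠ 0 ∧ ∃ b, j b = algebraMap A M d * c := fun c => by
    obtain ⟨p, rfl⟩ := AdjoinRoot.mk_surjective c
    obtain ⟨q, hq, hqp⟩ := IsLocalization.integerNormalization_spec (nonZeroDivisors A) p
    refine ⟨q, nonZeroDivisors.ne_zero hq,
      AdjoinRoot.mk g (IsLocalization.integerNormalization (nonZeroDivisors A) p), ?_⟩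
    rw [hjmk, hqp, ← algebraMap_smul F q p, ← Polynomial.C_mul', map_mul,
      IsScalarTower.algebraMap_apply A F M]
    rfl
  -- A conductor: the normalization `C` is a finite `A`-module, so a single `d` multiplies it into
  -- `A[Y] / (g)`. A point `ξ` of the latter with `x d ≠ 0` then extends to `C` by `c ↦ ξ(d c) /
  -- x(d)`.
  obtain ⟨d, hd0, hd⟩ : ∃ d : A, d ≠ 0 ∧ ∀ c : C, ∃ b, j b = algebraMap A M d * c := by
    obtain ⟨s, hs⟩ := Module.Finite.fg_top (R := A) (M := C)
    choose d hd0 hd using fun c : C => hex c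
    refine ⟨∏ c ∈ s, d c, Finset.prod_ne_zero_iff.mpr fun c _ => hd0 c, fun c => ?_⟩
    have hc : c ∈ Submodule.span A (s : Set C) := hs ▸ Submodule.mem_top
    induction hc using Submodule.span_induction with
    | mem c hc =>
      classical
      obtain ⟨b, hb⟩ := hd c
      refine ⟨algebraMap A _ (∏ c ∈ s.erase c, d c) * b, ?_⟩
      rw [map_mul, AlgHom.commutes, hb, ← mul_assoc, ← map_mul, Finset.prod_erase_mul _ _ hc]
    | zero => exact ⟨0, by simp⟩
    | add c c' _ _ h h' =>
      obtain ⟨b, hb⟩ := h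
      obtain ⟨b', hb'⟩ := h'
      exact ⟨b + b', by rw [map_add, hb, hb', ← mul_add]; rfl⟩
    | smul a c _ h =>
      obtain ⟨b, hb⟩ := h
      refine ⟨a • b, ?_⟩
      rw [map_smul, hb, ← mul_smul_comm]
      rfl
  refine ⟨d, hd0, fun x y hxd hy => ?_⟩
  let ξ : AdjoinRoot g →+* K := AdjoinRoot.lift x y hy
  have hξ : ∀ a, ξ (algebraMap A _ a) = x a := fun a => AdjoinRoot.lift_of hy
  choose β hβ using hd
  have huniq : ∀ (c : C) b, j b = algebraMap A M d * c → β c = b := fun c b hb =>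
    hj ((hβ c).trans hb.symm)
  refine ⟨{ toFun := fun c => ξ (β c) / x d
            map_one' := ?_
            map_mul' := fun c c' => ?_
            map_zero' := ?_
            map_add' := fun c c' => ?_ }, fun a => ?_⟩
  · rw [huniq 1 (algebraMap A _ d) (by rw [j.commutes, OneMemClass.coe_one, mul_one]), hξ, div_self hxd]
  · have h1 : j (algebraMap A _ d * β (c * c')) = j (β c * β c') := by
      rw [map_mul, map_mul, hβ, hβ, hβ, AlgHom.commutes, Subalgebra.coe_mul]
      ring
    have h2 := congrArg ξ (hj h1)
    rw [map_mul, map_mul, hξ] at h2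
    field_simp
    linear_combination h2
  · rw [huniq 0 0 (by simp), map_zero, zero_div]
  · rw [huniq (c + c') (β c + β c') (by rw [map_add, hβ, hβ, ← mul_add]; rfl), map_add, add_div]
  · change ξ (β (algebraMap A C a)) / x d = x a
    rw [huniq (algebraMap A C a) (algebraMap A _ (d * a)) (by
      rw [AlgHom.commutes, map_mul]; rfl), hξ, map_mul, mul_div_cancel_left₀ _ hxd]

/-- Since `g` divides `f(φ, Y)`, sending `t` to `φ` embeds the function field of `f` into `F[Y] /
(g)`, and integrality over `K[t]` is unchanged by a field embedding. The witnesses `x`, `z` of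
ramification over `p` thus survive and contradict the property of `φ` for étale covers. -/
theorem not_etale_integralClosure {K A F : Type u} [Field K] [CommRing A] [IsDomain A]
    [Algebra K A] [Field F] [Algebra A F] [IsFractionRing A F] {f : K[X][X]} (hf : f.Monic)
    (hirr : Irreducible f) {φ : A} (hφ : Transcendental K φ) {p : K[X]} (hp : Irreducible p)
    {x z : FunctionRing f} (hx : IsIntegral K[X] x) (hz : IsIntegral K[X] z)
    (hxz : ∃ n : ℕ, x ^ n = algebraMap K[X] _ p * z)
    (hw : ∀ w, x = algebraMap K[X] _ p * w → ¬ IsIntegral K[X] w)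
    (hφM : ∀ (M : Type u) [Field M] [Algebra A M] [Algebra K M]
      [IsScalarTower K A M] [FaithfulSMul A M], Algebra.Etale A (integralClosure A M) →
      ∀ x z : M, IsIntegral (Algebra.adjoin K {algebraMap A M φ}) x →
      IsIntegral (Algebra.adjoin K {algebraMap A M φ}) z →
      (∃ n : ℕ, x ^ n = aeval (algebraMap A M φ) p * z) →
      IsIntegral (Algebra.adjoin K {algebraMap A M φ}) (x / aeval (algebraMap A M φ) p))
    {g : F[X]} (hg : Irreducible g)
    (hgf : g ∣ (f.map (aeval φ : K[X] →ₐ[K] A).toRingHom).map (algebraMap A F)) :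
    ¬ Algebra.Etale A (integralClosure A (AdjoinRoot g)) := by
  intro het
  have : Fact (Irreducible g) := ⟨hg⟩
  have : Fact (Irreducible (f.map (algebraMap K[X] (RatFunc K)))) :=
    ⟨irreducible_map_ratFunc hf hirr⟩
  let M := AdjoinRoot g
  let : Algebra K F := ((algebraMap A F).comp (algebraMap K A)).toAlgebra
  have : IsScalarTower K A F := IsScalarTower.of_algebraMap_eq fun _ => rfl
  have : IsScalarTower K A M := inferInstance
  have hAM : Function.Injective (algebraMap A M) := by
    rw [IsScalarTower.algebraMap_eq A F M]
    exact (algebraMap F M).injective.comp (IsFractionRing.injective A F)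
  have : FaithfulSMul A M := (faithfulSMul_iff_algebraMap_injective A M).mpr hAM
  set φM := algebraMap A M φ
  have hinj : Function.Injective (aeval φM : K[X] →ₐ[K] M) := by
    rw [injective_iff_map_eq_zero]
    intro q hq
    rw [aeval_algebraMap_apply, map_eq_zero_iff _ hAM] at hq
    exact (transcendental_iff.mp hφ) q hq
  let j₀ : RatFunc K →+* M := IsFractionRing.lift (A := K[X]) (g := (aeval φM : K[X] →ₐ[K] M).toRingHom) hinj
  have hj₀ : ∀ q, j₀ (algebraMap K[X] _ q) = aeval φM q := fun q => IsFractionRing.lift_algebraMap hinj q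
  let j : FunctionRing f →+* M := AdjoinRoot.lift j₀ (AdjoinRoot.root g) (by
    have h0 : aeval (AdjoinRoot.root g) ((f.map (aeval φ : K[X] →ₐ[K] A).toRingHom).map
        (algebraMap A F)) = 0 := by
      rw [AdjoinRoot.aeval_eq]
      exact AdjoinRoot.mk_eq_zero.mpr hgf
    rw [aeval_map_algebraMap, aeval_def, eval₂_map] at h0
    rw [eval₂_map, ← h0]
    congr 1
    refine RingHom.ext fun q => (hj₀ q).trans ?_
    exact aeval_algebraMap_apply M φ q)
  have hj : ∀ q : K[X], j (algebraMap K[X] _ q) = aeval φM q := fun q => by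
    rw [IsScalarTower.algebraMap_apply K[X] (RatFunc K) (FunctionRing f), ← hj₀]
    exact AdjoinRoot.lift_of _
  have hjcomp : j.comp (algebraMap K[X] _) = (aeval φM : K[X] →ₐ[K] M).toRingHom := RingHom.ext hj
  have hint : ∀ y, IsIntegral (Algebra.adjoin K {φM}) (j y) ↔ IsIntegral K[X] y := fun y => by
    have h1 : IsIntegral K[X] y ↔ (aeval φM : K[X] →ₐ[K] M).toRingHom.IsIntegralElem (j y) := by
      rw [← hjcomp]
      constructor
      · rintro ⟨P, hP, hPy⟩
        exact ⟨P, hP, by rw [← hom_eval₂, hPy, map_zero]⟩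
      · rintro ⟨P, hP, hPy⟩
        exact ⟨P, hP, j.injective (by rw [hom_eval₂, hPy, map_zero])⟩
    rw [h1]
    have hrange : ∀ w : M, w ∈ Algebra.adjoin K {φM} ↔
        w ∈ (aeval φM : K[X] →ₐ[K] M).toRingHom.range := fun w => by
      rw [Algebra.adjoin_singleton_eq_range_aeval]; rfl
    exact ⟨isIntegral_of_range_le fun r => (hrange _).mp r.2,
      isIntegral_of_range_le fun r => ⟨⟨_, (hrange _).mpr ⟨r, rfl⟩⟩, rfl⟩⟩
  have hp0 : algebraMap K[X] (FunctionRing f) p ≠ 0 := fun h0 => by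
    have := congrArg j h0
    rw [hj, map_zero] at this
    exact hp.ne_zero (hinj (by rw [this, map_zero]))
  have h1 := hφM M het (j x) (j z) ((hint x).mpr hx) ((hint z).mpr hz) (by
    obtain ⟨n, hn⟩ := hxz
    exact ⟨n, by rw [← map_pow, hn, map_mul, hj]⟩)
  refine hw (x / algebraMap K[X] _ p) (by field_simp) ((hint _).mp ?_)
  rw [map_div₀, hj]
  exact h1

end HilbertProperty

end

/-! ### Pulling back finitely many polynomials to a normal domain -/

noncomputable section

namespace HilbertProperty

open Polynomial

/-- The domain `A` need not be factorial. Splitting a monic polynomial into monic factors still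
terminates by degree, and Gauss's lemma over an integrally closed domain makes the indecomposable
ones irreducible over `F`. -/
theorem exists_multiset_prod_eq_of_monic (A F : Type*) [CommRing A] [IsDomain A]
    [IsIntegrallyClosed A] [Field F] [Algebra A F] [IsFractionRing A F] {h : A[X]}
    (hh : h.Monic) : ∃ s : Multiset A[X],
      (∀ g ∈ s, g.Monic ∧ Irreducible (g.map (algebraMap A F))) ∧ s.prod = h := by
  induction hn : h.natDegree using Nat.strong_induction_on generalizing h with
  | _ n ih =>
    by_cases h1 : h = 1
    · exact ⟨0, by simp, by simp [h1]⟩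
    by_cases hirr : Irreducible h
    · exact ⟨{h}, by
        simpa using ⟨hh, (hh.irreducible_iff_irreducible_map_fraction_map (K := F)).mp hirr⟩,
        by simp⟩
    rw [hh.irreducible_iff_natDegree'] at hirr
    push Not at hirr
    obtain ⟨a, b, ha, hb, hab, hdeg⟩ := hirr h1
    rw [Finset.mem_Ioc] at hdeg
    have hsum : a.natDegree + b.natDegree = n := by rw [← ha.natDegree_mul hb, hab, hn]
    have hb' : b.natDegree < n := by
      rw [hn] at hdeg
      omega
    obtain ⟨s, hs, hsa⟩ := ih _ (by omega) ha rfl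
    obtain ⟨t, ht, htb⟩ := ih _ hb' hb rfl
    refine ⟨s + t, fun g hg => ?_, by rw [Multiset.prod_add, hsa, htb, hab]⟩
    rcases Multiset.mem_add.mp hg with hg | hg
    exacts [hs g hg, ht g hg]

/-- Finitely many polynomials over `K[t]` showing that `K` is not Hilbertian can be pulled back to
finitely many ramified normal extensions of a finitely generated normal domain `A`, through which
almost all rational points of `A` lift. -/
theorem exists_finite_not_etale_family {K A : Type u} [Field K] [CharZero K] [CommRing A]
    [IsDomain A] [Algebra K A] [Algebra.FiniteType K A] [IsIntegrallyClosed A]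
    (hA : ¬ Algebra.IsIntegral K A) (F : Type u) [Field F] [Algebra A F] [IsFractionRing A F]
    (Φ : Finset K[X][X])
    (hΦ : ∀ f ∈ Φ, f.Monic ∧ Irreducible f ∧ 2 ≤ f.natDegree) {s : K[X]} (hs : s ≠ 0)
    (hsΦ : ∀ a, s.eval a ≠ 0 → ∃ f ∈ Φ, ∃ y, f.eval₂ (evalRingHom a) y = 0) :
    ∃ G : Finset A[X], (∀ g ∈ G, Irreducible (g.map (algebraMap A F)) ∧
        ¬ Algebra.Etale A (integralClosure A (AdjoinRoot (g.map (algebraMap A F))))) ∧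
      ∃ d : A, d ≠ 0 ∧ ∀ x : A →ₐ[K] K, x d ≠ 0 → ∃ g ∈ G,
        ∃ x' : integralClosure A (AdjoinRoot (g.map (algebraMap A F))) →+* K,
          ∀ a, x' (algebraMap A _ a) = x a := by
  classical
  have : IsNoetherianRing A := Algebra.FiniteType.isNoetherianRing K A
  have : CharZero F := by
    let : Algebra K F := ((algebraMap A F).comp (algebraMap K A)).toAlgebra
    exact charZero_of_injective_algebraMap (algebraMap K F).injective
  have hdich : ∀ f ∈ Φ, _ ∨ _ := fun f hf =>
    exists_ramified_or_finite (hΦ f hf).1 (hΦ f hf).2.1 (hΦ f hf).2.2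
  let R : K[X][X] → Prop := fun f => ∃ p : K[X], Irreducible p ∧ ∃ x z : FunctionRing f,
    IsIntegral K[X] x ∧ IsIntegral K[X] z ∧ (∃ n : ℕ, x ^ n = algebraMap K[X] _ p * z) ∧
      ∀ w, x = algebraMap K[X] _ p * w → ¬ IsIntegral K[X] w
  -- The exceptional values of `a` for the polynomials without a ramified point; the default `1`
  -- makes the other ones harmless in the product. The same device is used for `p` and `d` below.
  have hq : ∀ f, ∃ q : K[X], q ≠ 0 ∧ (f ∈ Φ → ¬ R f →
      ∀ a c, f.eval₂ (evalRingHom a) c = 0 → q.eval a = 0) := fun f => by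
    by_cases hf : f ∈ Φ ∧ ¬ R f
    · obtain ⟨q, hq0, hq⟩ := (hdich f hf.1).resolve_right hf.2
      exact ⟨q, hq0, fun _ _ => hq⟩
    · exact ⟨1, one_ne_zero, fun h1 h2 => (hf ⟨h1, h2⟩).elim⟩
  choose q hq0 hq using hq
  have hp : ∀ f, ∃ p : K[X], p ≠ 0 ∧ (R f → Irreducible p ∧ ∃ x z : FunctionRing f,
    IsIntegral K[X] x ∧ IsIntegral K[X] z ∧ (∃ n : ℕ, x ^ n = algebraMap K[X] _ p * z) ∧
      ∀ w, x = algebraMap K[X] _ p * w → ¬ IsIntegral K[X] w) := fun f => by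
    by_cases hf : R f
    · obtain ⟨p, hp, h⟩ := hf
      exact ⟨p, hp.ne_zero, fun _ => ⟨hp, h⟩⟩
    · exact ⟨1, one_ne_zero, fun h => (hf h).elim⟩
  choose p hp0 hp using hp
  -- Taking the product of all branch points as `P` yields one parameter for the whole family.
  obtain ⟨φ, hφ, hφM⟩ := exists_parameter (A := A) hA
    (Finset.prod_ne_zero_iff.mpr fun f (_ : f ∈ Φ) => hp0 f)
  let e : K[X] →+* A := (aeval φ : K[X] →ₐ[K] A).toRingHom
  have hfac : ∀ f : K[X][X], ∃ m : Multiset A[X], f ∈ Φ →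
      (∀ g ∈ m, g.Monic ∧ Irreducible (g.map (algebraMap A F))) ∧ m.prod = f.map e := fun f => by
    by_cases hf : f ∈ Φ
    · obtain ⟨m, hm⟩ := exists_multiset_prod_eq_of_monic A F ((hΦ f hf).1.map e)
      exact ⟨m, fun _ => hm⟩
    · exact ⟨0, fun h => (hf h).elim⟩
  choose m hm using hfac
  let G : Finset A[X] := (Φ.filter R).biUnion fun f => (m f).toFinset
  have hG : ∀ g ∈ G, ∃ f ∈ Φ, R f ∧ g ∈ m f := fun g hg => by
    obtain ⟨f, hf, hgf⟩ := Finset.mem_biUnion.mp hg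
    exact ⟨f, (Finset.mem_filter.mp hf).1, (Finset.mem_filter.mp hf).2, Multiset.mem_toFinset.mp hgf⟩
  have hd : ∀ g : A[X], ∃ d : A, d ≠ 0 ∧ (g ∈ G → ∀ (x : A →+* K) (y : K), x d ≠ 0 →
      g.eval₂ x y = 0 → ∃ x' : integralClosure A (AdjoinRoot (g.map (algebraMap A F))) →+* K,
        ∀ a, x' (algebraMap A _ a) = x a) := fun g => by
    by_cases hg : g ∈ G
    · obtain ⟨f, hf, -, hgf⟩ := hG g hg
      obtain ⟨d, hd0, hd⟩ := exists_lift_integralClosure (F := F) (K := K)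
        ((hm f hf).1 g hgf).1 ((hm f hf).1 g hgf).2
      exact ⟨d, hd0, fun _ => hd⟩
    · exact ⟨1, one_ne_zero, fun h => (hg h).elim⟩
  choose d hd0 hd using hd
  have he : Function.Injective e := (injective_iff_map_eq_zero e).mpr (transcendental_iff.mp hφ)
  -- Nonvanishing of this element at `x` ensures three things: some `f ∈ Φ` has a root over `φ(x)`,
  -- that `f` has a ramified point, and the resulting root of a factor `g` lifts to the
  -- normalization.
  refine ⟨G, fun g hg => ?_, e (s * ∏ f ∈ Φ, q f) * ∏ g ∈ G, d g, mul_ne_zero ?_ ?_,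
    fun x hx => ?_⟩
  · obtain ⟨f, hf, hR, hgf⟩ := hG g hg
    have hirr := ((hm f hf).1 g hgf).2
    obtain ⟨hpf, x, z, hx, hz, hxz, hw⟩ := hp f hR
    refine ⟨hirr, not_etale_integralClosure (hΦ f hf).1 (hΦ f hf).2.1 hφ hpf hx hz hxz hw ?_ hirr ?_⟩
    · intro M _ _ _ _ _ het
      exact hφM M het (p f) hpf (Finset.dvd_prod_of_mem p hf)
    · refine Polynomial.map_dvd _ ?_
      change g ∣ f.map e
      rw [← (hm f hf).2]
      exact Multiset.dvd_prod hgf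
  · rw [map_ne_zero_iff e he]
    exact mul_ne_zero hs (Finset.prod_ne_zero_iff.mpr fun f _ => hq0 f)
  · exact Finset.prod_ne_zero_iff.mpr fun g _ => hd0 g
  · have hxe : ∀ r : K[X], x (e r) = r.eval (x φ) := fun r => by
      change x (aeval φ r) = _
      rw [← aeval_algHom_apply, coe_aeval_eq_eval]
    rw [map_mul, hxe, eval_mul, eval_prod, map_prod] at hx
    obtain ⟨⟨hxs, hxq⟩, hxd⟩ : (s.eval (x φ) ≠ 0 ∧ ∏ f ∈ Φ, (q f).eval (x φ) ≠ 0) ∧ _ :=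
      ⟨mul_ne_zero_iff.mp (mul_ne_zero_iff.mp hx).1, (mul_ne_zero_iff.mp hx).2⟩
    obtain ⟨f, hf, y, hy⟩ := hsΦ _ hxs
    have hR : R f := by
      by_contra hR
      exact Finset.prod_ne_zero_iff.mp hxq f hf (hq f hf hR _ y hy)
    have h0 : ((m f).map fun g => g.eval₂ (x : A →+* K) y).prod = 0 := by
      have h1 : ((m f).map fun g => g.eval₂ (x : A →+* K) y).prod =
          (m f).prod.eval₂ (x : A →+* K) y :=
        (map_multiset_prod (eval₂RingHom (x : A →+* K) y) (m f)).symm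
      rw [h1, (hm f hf).2, eval₂_map, ← hy]
      congr 1
      exact RingHom.ext hxe
    obtain ⟨g, hg, hgy⟩ := Multiset.mem_map.mp (Multiset.prod_eq_zero_iff.mp h0)
    have hgG : g ∈ G := Finset.mem_biUnion.mpr
      ⟨f, Finset.mem_filter.mpr ⟨hf, hR⟩, Multiset.mem_toFinset.mpr hg⟩
    exact ⟨g, hgG, hd g hgG x y (Finset.prod_ne_zero_iff.mp hxd g hgG) hgy⟩

end HilbertProperty

end

/-! ### Normalization of a variety in an extension of its function field -/

noncomputable section

namespace HilbertProperty

/-- The point of an integral scheme `X` given by an extension `M` of its function field. -/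
def fieldPoint (X : Scheme.{u}) [IsIntegral X] (M : Type u) [Field M] [Algebra X.functionField M] :
    Spec (CommRingCat.of M) ⟶ X :=
  Spec.map (CommRingCat.ofHom (algebraMap X.functionField M)) ≫ X.fromSpecStalk (genericPoint X)

section

variable (X : Scheme.{u}) [IsIntegral X] (M : Type u) [Field M] [Algebra X.functionField M]

theorem fieldPoint_preimage (U : X.Opens) [h : Nonempty U] : fieldPoint X M ⁻¹ᵁ U = ⊤ := by
  have hη : genericPoint X ∈ U :=
    ((genericPoint_spec X).mem_open_set_iff U.isOpen).mpr (by simpa using h)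
  have h1 : X.fromSpecStalk (genericPoint X) ⁻¹ᵁ U = ⊤ := by
    refine top_le_iff.mp fun y _ => ?_
    have h2 : X.fromSpecStalk (genericPoint X) y ∈ Set.range (X.fromSpecStalk (genericPoint X)) :=
      ⟨y, rfl⟩
    rw [Scheme.range_fromSpecStalk] at h2
    exact h2.mem_open U.isOpen hη
  rw [fieldPoint, Scheme.Hom.comp_preimage, h1]
  rfl

theorem comp_appLE_top {X Y Z : Scheme.{u}} (f : Z ⟶ Y) (g : Y ⟶ X) (U : X.Opens)
    (α : Γ(X, U) ⟶ Γ(Y, ⊤)) (hα : g.app U = α ≫ Y.presheaf.map (homOfLE le_top).op)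
    (e : ⊤ ≤ (f ≫ g) ⁻¹ᵁ U) : (f ≫ g).appLE U ⊤ e = α ≫ f.appTop := by
  rw [Scheme.Hom.comp_appLE, hα, Category.assoc]
  congr 1
  exact (Scheme.Hom.map_appLE ..).trans (Scheme.Hom.appLE_eq_app ..)

theorem fieldPoint_appLE (U : X.Opens) [Nonempty U] :
    (fieldPoint X M).appLE U ⊤ (fieldPoint_preimage X M U).ge ≫
      (Scheme.ΓSpecIso (CommRingCat.of M)).hom =
        X.germToFunctionField U ≫ CommRingCat.ofHom (algebraMap X.functionField M) := by
  have hη : genericPoint X ∈ U :=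
    ((genericPoint_spec X).mem_open_set_iff U.isOpen).mpr (by simpa using ‹Nonempty U›)
  have h1 : (fieldPoint X M).appLE U ⊤ (fieldPoint_preimage X M U).ge =
      (X.germToFunctionField U ≫ (Scheme.ΓSpecIso X.functionField).inv) ≫
        (Spec.map (CommRingCat.ofHom (algebraMap X.functionField M))).appTop :=
    comp_appLE_top _ _ _ _ ((Scheme.fromSpecStalk_app hη).trans (Category.assoc _ _ _).symm) _
  rw [h1, Category.assoc, Category.assoc, Scheme.ΓSpecIso_naturality]
  congr 1
  exact Iso.inv_hom_id_assoc _ _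

variable [QuasiCompact (fieldPoint X M)] [QuasiSeparated (fieldPoint X M)]

/-- The relative normalization is locally the integral closure in the sections of `Spec M` over the
preimage of `U`. That preimage is all of `Spec M`, because its point maps to the generic point. This
reduces finiteness, normality, étaleness and lifting of points to commutative algebra. -/
theorem exists_ringEquiv_sections {U : X.Opens} (hU : IsAffineOpen U) [Nonempty U]
    [Algebra Γ(X, U) M] [IsScalarTower Γ(X, U) X.functionField M] :
    ∃ e : Γ((fieldPoint X M).normalization, (fieldPoint X M).fromNormalization ⁻¹ᵁ U) ≃+*
        integralClosure Γ(X, U) M,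
      ∀ a, e ((fieldPoint X M).fromNormalization.app U a) = algebraMap _ _ a := by
  let : Algebra Γ(X, U) Γ(Spec (CommRingCat.of M), fieldPoint X M ⁻¹ᵁ U) :=
    ((fieldPoint X M).app U).hom.toAlgebra
  let i : Γ(Spec (CommRingCat.of M), fieldPoint X M ⁻¹ᵁ U) ≅ CommRingCat.of M :=
    (Spec (CommRingCat.of M)).presheaf.mapIso (eqToIso (fieldPoint_preimage X M U).symm).op ≪≫
      Scheme.ΓSpecIso (CommRingCat.of M)
  let j : Γ(Spec (CommRingCat.of M), fieldPoint X M ⁻¹ᵁ U) ≃ₐ[Γ(X, U)] M :=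
    AlgEquiv.ofRingEquiv (f := i.commRingCatIsoToRingEquiv) fun a => by
      rw [IsScalarTower.algebraMap_apply Γ(X, U) X.functionField M]
      exact congr($(fieldPoint_appLE X M U) a)
  refine ⟨((fieldPoint X M).normalizationObjIso hU).commRingCatIsoToRingEquiv.trans
    j.mapIntegralClosure.toRingEquiv, fun a => ?_⟩
  have h1 := (fieldPoint X M).fromNormalization_app hU
  have h2 : ((fieldPoint X M).normalizationObjIso hU).hom
      ((fieldPoint X M).fromNormalization.app U a) = algebraMap Γ(X, U) _ a := by
    rw [h1]
    simp
  change j.mapIntegralClosure (((fieldPoint X M).normalizationObjIso hU).hom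
      ((fieldPoint X M).fromNormalization.app U a)) = _
  rw [h2]
  exact j.mapIntegralClosure.commutes a

end

theorem isIntegrallyClosed_sections {X : Scheme.{u}} [IsIntegral X]
    (h : ∀ x : X, IsIntegrallyClosed (X.presheaf.stalk x)) {U : X.Opens} (hU : IsAffineOpen U)
    [Nonempty U] : IsIntegrallyClosed Γ(X, U) := by
  refine IsIntegrallyClosed.of_localization_maximal fun P _ hP => ?_
  let y : PrimeSpectrum Γ(X, U) := ⟨P, hP.isPrime⟩
  have hy : hU.fromSpec y ∈ U := by
    rw [← SetLike.mem_coe, ← hU.range_fromSpec]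
    exact ⟨y, rfl⟩
  have := h (hU.fromSpec y)
  let := TopCat.Presheaf.algebra_section_stalk X.presheaf (⟨hU.fromSpec y, hy⟩ : U)
  have hl : IsLocalization.AtPrime (X.presheaf.stalk (hU.fromSpec y)) P :=
    hU.isLocalization_stalk' y hy
  exact IsIntegrallyClosed.of_equiv (IsLocalization.algEquiv P.primeCompl
    (X.presheaf.stalk (hU.fromSpec y)) (Localization.AtPrime P)).toRingEquiv

theorem isIntegrallyClosed_stalk {X : Scheme.{u}} [IsIntegral X] {U : X.Opens}
    (hU : IsAffineOpen U) {x : X} (hx : x ∈ U) [IsIntegrallyClosed Γ(X, U)] :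
    IsIntegrallyClosed (X.presheaf.stalk x) := by
  have : Nonempty U := ⟨⟨x, hx⟩⟩
  let := TopCat.Presheaf.algebra_section_stalk X.presheaf (⟨x, hx⟩ : U)
  have : IsLocalization.AtPrime (X.presheaf.stalk x) (hU.primeIdealOf ⟨x, hx⟩).asIdeal :=
    hU.isLocalization_stalk ⟨x, hx⟩
  exact isIntegrallyClosed_of_isLocalization (X.presheaf.stalk x) _
    (hU.primeIdealOf ⟨x, hx⟩).asIdeal.primeCompl_le_nonZeroDivisors

variable {K : Type u} [Field K]

/-- The structure homomorphism of the ring of sections of a `K`-scheme. -/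
def sectionsMap (X : SchemeOver K) (U : X.left.Opens) : K →+* Γ(X.left, U) :=
  ((Scheme.ΓSpecIso (CommRingCat.of K)).inv ≫ X.hom.appLE ⊤ U le_top).hom

theorem finiteType_sectionsMap (X : SchemeOver K) [LocallyOfFiniteType X.hom] {U : X.left.Opens}
    (hU : IsAffineOpen U) : (sectionsMap X U).FiniteType := by
  refine RingHom.FiniteType.comp (X.hom.finiteType_appLE (isAffineOpen_top _) hU _)
    (RingHom.FiniteType.of_surjective _ ?_)
  exact (Scheme.ΓSpecIso (CommRingCat.of K)).commRingCatIsoToRingEquiv.symm.surjective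

theorem isNoetherianRing_sections (X : SchemeOver K) [LocallyOfFiniteType X.hom] {U : X.left.Opens}
    (hU : IsAffineOpen U) : IsNoetherianRing Γ(X.left, U) := by
  let := (sectionsMap X U).toAlgebra
  have : Algebra.FiniteType K Γ(X.left, U) := finiteType_sectionsMap X hU
  exact Algebra.FiniteType.isNoetherianRing K _

theorem charZero_functionField (X : SchemeOver K) [IsIntegral X.left] [CharZero K] :
    CharZero X.left.functionField :=
  have : Nonempty (⊤ : X.left.Opens) := ⟨⟨genericPoint X.left, trivial⟩⟩
  charZero_of_injective_ringHom
    ((X.left.germToFunctionField ⊤).hom.comp (sectionsMap X ⊤)).injective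

section

variable (X : SchemeOver K) [IsIntegral X.left] (M : Type u) [Field M]
  [Algebra X.left.functionField M]

theorem isAffineHom_fieldPoint [IsSeparated X.hom] : IsAffineHom (fieldPoint X.left M) :=
  MorphismProperty.of_postcomp (W := @IsAffineHom) (W' := @IsSeparated) _ X.hom inferInstance
    inferInstance

variable [QuasiCompact (fieldPoint X.left M)] [QuasiSeparated (fieldPoint X.left M)]

/-- The normalization of `X` in an extension of its function field. -/
def normalizationIn : SchemeOver K :=
  Over.mk ((fieldPoint X.left M).fromNormalization ≫ X.hom)

/-- The normalization morphism. -/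
def fromNormalizationIn : normalizationIn X M ⟶ X :=
  Over.homMk (fieldPoint X.left M).fromNormalization rfl

theorem isFinite_fromNormalization [CharZero K] (hX : IsNormalVariety X)
    [FiniteDimensional X.left.functionField M] :
    IsFinite (fieldPoint X.left M).fromNormalization := by
  have := hX.locallyOfFiniteType
  have := charZero_functionField X
  refine (isFinite_iff _).mpr ⟨inferInstance, fun U hU => ?_⟩
  -- The function field is the fraction field of `Γ(X, U)` only for nonempty `U`.
  rcases isEmpty_or_nonempty U with hU0 | hU0
  · obtain rfl : U = ⊥ := by
      rw [← TopologicalSpace.Opens.coe_inj]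
      exact Set.isEmpty_coe_sort.mp hU0
    have h0 : Subsingleton Γ((fieldPoint X.left M).normalization,
        (fieldPoint X.left M).fromNormalization ⁻¹ᵁ ⊥) := by
      rw [Scheme.Hom.preimage_bot]
      infer_instance
    exact RingHom.Finite.of_surjective _ fun a => ⟨0, Subsingleton.elim _ _⟩
  have := isIntegrallyClosed_sections hX.isIntegrallyClosed_stalk hU
  have := isNoetherianRing_sections X hU
  have := functionField_isFractionRing_of_isAffineOpen X.left U hU
  let : Algebra Γ(X.left, U) M :=
    ((algebraMap X.left.functionField M).comp (algebraMap Γ(X.left, U) _)).toAlgebra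
  have : IsScalarTower Γ(X.left, U) X.left.functionField M :=
    IsScalarTower.of_algebraMap_eq fun _ => rfl
  obtain ⟨e, he⟩ := exists_ringEquiv_sections X.left M hU
  have hfin := finite_integralClosure_of_fractionField Γ(X.left, U) X.left.functionField M
  have h1 : ((fieldPoint X.left M).fromNormalization.app U).hom =
      (e.symm : _ →+* _).comp (algebraMap Γ(X.left, U) (integralClosure Γ(X.left, U) M)) :=
    RingHom.ext fun a => (e.symm_apply_eq.mpr (he a).symm).symm
  rw [h1]
  exact (RingHom.Finite.of_surjective _ e.symm.surjective).comp
    (RingHom.finite_algebraMap.mpr hfin)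

theorem isCover_fromNormalizationIn [CharZero K] (hX : IsNormalVariety X)
    [FiniteDimensional X.left.functionField M] : IsCover (fromNormalizationIn X M) := by
  have hfin : IsFinite (fieldPoint X.left M).fromNormalization :=
    isFinite_fromNormalization X M hX
  have := hX.locallyOfFiniteType
  have := hX.quasiCompact
  have := hX.isSeparated
  have hint : IsIntegral (fieldPoint X.left M).normalization := inferInstance
  refine ⟨⟨⟨hint, ?_, ?_, ?_⟩, fun x => ?_⟩, hX, hfin, ⟨fun x => ?_⟩⟩
  · exact inferInstanceAs (IsSeparated ((fieldPoint X.left M).fromNormalization ≫ X.hom))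
  · exact inferInstanceAs (LocallyOfFiniteType ((fieldPoint X.left M).fromNormalization ≫ X.hom))
  · exact inferInstanceAs (QuasiCompact ((fieldPoint X.left M).fromNormalization ≫ X.hom))
  · obtain ⟨_, ⟨U, hU, rfl⟩, hxU, -⟩ := X.left.isBasis_affineOpens.exists_subset_of_mem_open
      (Set.mem_univ ((fieldPoint X.left M).fromNormalization x)) isOpen_univ
    have : Nonempty U := ⟨⟨_, hxU⟩⟩
    have := charZero_functionField X
    have := functionField_isFractionRing_of_isAffineOpen X.left U hU
    let : Algebra Γ(X.left, U) M :=
      ((algebraMap X.left.functionField M).comp (algebraMap Γ(X.left, U) _)).toAlgebra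
    have : IsScalarTower Γ(X.left, U) X.left.functionField M :=
      IsScalarTower.of_algebraMap_eq fun _ => rfl
    obtain ⟨e, -⟩ := exists_ringEquiv_sections X.left M hU
    have : IsIntegrallyClosed (integralClosure Γ(X.left, U) M) :=
      integralClosure.isIntegrallyClosedOfFiniteExtension X.left.functionField
    have : IsIntegrallyClosed Γ((fieldPoint X.left M).normalization,
      (fieldPoint X.left M).fromNormalization ⁻¹ᵁ U) := IsIntegrallyClosed.of_equiv e.symm
    have hV := hU.preimage (fieldPoint X.left M).fromNormalization
    exact isIntegrallyClosed_stalk (X := (fieldPoint X.left M).normalization) hV hxU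
  · have hcl : IsClosed (Set.range (fieldPoint X.left M).fromNormalization) :=
      (fieldPoint X.left M).fromNormalization.isClosedMap.isClosed_range
    let p : Spec (CommRingCat.of M) := (⊥ : PrimeSpectrum M)
    have h1 : fieldPoint X.left M p ⤳ genericPoint X.left := by
      have h2 : fieldPoint X.left M p ∈ Set.range (X.left.fromSpecStalk (genericPoint X.left)) :=
        ⟨_, rfl⟩
      rwa [Scheme.range_fromSpecStalk] at h2
    have h3 : fieldPoint X.left M p ∈ Set.range (fieldPoint X.left M).fromNormalization :=
      ⟨(fieldPoint X.left M).toNormalization p, by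
        rw [← Scheme.Hom.comp_apply, Scheme.Hom.toNormalization_fromNormalization]⟩
    exact (h1.trans ((genericPoint_spec X.left).specializes trivial)).mem_closed hcl h3

theorem isRamified_fromNormalizationIn {U : X.left.Opens} (hU : IsAffineOpen U) [Nonempty U]
    [Algebra Γ(X.left, U) M] [IsScalarTower Γ(X.left, U) X.left.functionField M]
    (h : ¬ Algebra.Etale Γ(X.left, U) (integralClosure Γ(X.left, U) M)) :
    IsRamified (fromNormalizationIn X M) := by
  intro het
  have het : Etale (fieldPoint X.left M).fromNormalization := het
  obtain ⟨e, he⟩ := exists_ringEquiv_sections X.left M hU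
  have h1 := HasRingHomProperty.appLE @Etale _ het ⟨U, hU⟩ ⟨_, hU.preimage _⟩ le_rfl
  rw [Scheme.Hom.appLE_eq_app] at h1
  have h2 := RingHom.Etale.respectsIso.1 _ e h1
  have h3 : e.toRingHom.comp ((fieldPoint X.left M).fromNormalization.app U).hom =
      algebraMap Γ(X.left, U) (integralClosure Γ(X.left, U) M) := RingHom.ext he
  exact h (RingHom.etale_algebraMap.mp (h3 ▸ h2))

/-- A rational point of an affine open `U`, as a homomorphism on sections, comes from a rational
point of `X`. -/
theorem mem_pointsImage_fromNormalizationIn {U : X.left.Opens} (hU : IsAffineOpen U) [Nonempty U]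
    [Algebra Γ(X.left, U) M] [IsScalarTower Γ(X.left, U) X.left.functionField M]
    (x : Points X) (x₀ : Γ(X.left, U) →+* K)
    (hx : x.left = Spec.map (CommRingCat.ofHom x₀) ≫ hU.fromSpec)
    (x' : integralClosure Γ(X.left, U) M →+* K) (hx' : ∀ a, x' (algebraMap _ _ a) = x₀ a) :
    x ∈ pointsImage (fromNormalizationIn X M) := by
  obtain ⟨e, he⟩ := exists_ringEquiv_sections X.left M hU
  let z := Spec.map (CommRingCat.ofHom (x'.comp (e : _ →+* _))) ≫
    (hU.preimage (fieldPoint X.left M).fromNormalization).fromSpec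
  have hz : z ≫ (fieldPoint X.left M).fromNormalization = x.left := by
    rw [hx, Category.assoc, ← IsAffineOpen.SpecMap_appLE_fromSpec _ hU _ le_rfl,
      ← Category.assoc, ← Spec.map_comp, Scheme.Hom.appLE_eq_app]
    congr 2
    ext a
    exact (congrArg x' (he a)).trans (hx' a)
  refine ⟨Over.homMk z ?_, ?_⟩
  · change z ≫ (fieldPoint X.left M).fromNormalization ≫ X.hom = _
    rw [← Category.assoc, hz]
    exact Over.w x
  · exact Over.OverMorphism.ext hz

end

end HilbertProperty

end

/-! ### Rational points and strong thinness -/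

noncomputable section

namespace HilbertProperty

open Polynomial

variable {K : Type u} [Field K]

theorem exists_isAffineOpen_not_isIntegral (X : SchemeOver K) [IsIntegral X.left]
    (hX : 0 < topologicalKrullDim X.left) :
    ∃ U : X.left.Opens, IsAffineOpen U ∧ Nonempty U ∧ ¬ (sectionsMap X U).IsIntegral := by
  obtain ⟨a, b, hab⟩ := Order.krullDim_pos_iff.mp hX
  obtain ⟨x, hx⟩ := a.isIrreducible.nonempty
  obtain ⟨_, ⟨U, hU, rfl⟩, hxU, -⟩ := X.left.isBasis_affineOpens.exists_subset_of_mem_open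
      (Set.mem_univ x) isOpen_univ
  have : Nonempty U := ⟨⟨_, hxU⟩⟩
  -- If `Γ(X, U)` were integral over `K`, it would be a field and `U` a single point, necessarily
  -- generic. As `U` meets the smaller closed set `a`, that set would be all of `X`.
  refine ⟨U, hU, this, fun hint => hab.not_ge ?_⟩
  let : Algebra K Γ(X.left, U) := (sectionsMap X U).toAlgebra
  have : Algebra.IsIntegral K Γ(X.left, U) := ⟨hint⟩
  have hfield : IsField Γ(X.left, U) := isField_of_isIntegral_of_isField' (Field.toIsField K)
  have hsub : Subsingleton (PrimeSpectrum Γ(X.left, U)) := by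
    let := hfield.toField
    infer_instance
  have hη : genericPoint X.left ∈ U :=
    ((genericPoint_spec X.left).mem_open_set_iff U.isOpen).mpr ⟨x, trivial, hxU⟩
  obtain ⟨p, rfl⟩ : x ∈ Set.range hU.fromSpec := by rwa [hU.range_fromSpec]
  obtain ⟨q, hq⟩ : genericPoint X.left ∈ Set.range hU.fromSpec := by rwa [hU.range_fromSpec]
  obtain rfl : p = q := Subsingleton.elim (α := PrimeSpectrum Γ(X.left, U)) p q
  intro y _
  rw [hq] at hx
  exact ((genericPoint_spec X.left).specializes (Set.mem_univ y)).mem_closed a.isClosed hx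

/-- The homomorphism `Γ(X, U) → K` of evaluation at a rational point of `U`. -/
def evalAt {X : SchemeOver K} (x : Points X) (U : X.left.Opens) (hx : ⊤ ≤ x.left ⁻¹ᵁ U) :
    Γ(X.left, U) →+* K :=
  (x.left.appLE U ⊤ hx ≫ (Scheme.ΓSpecIso (CommRingCat.of K)).hom).hom

theorem SpecMap_appLE_top_fromSpec {R : CommRingCat.{u}} {Y : Scheme.{u}} (x : Spec R ⟶ Y)
    {U : Y.Opens} (hx : ⊤ ≤ x ⁻¹ᵁ U) (hU : IsAffineOpen U) :
    Spec.map (x.appLE U ⊤ hx ≫ (Scheme.ΓSpecIso R).hom) ≫ hU.fromSpec = x := by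
  have h1 := IsAffineOpen.SpecMap_appLE_fromSpec x hU (isAffineOpen_top _) hx
  rw [Spec.map_comp, Category.assoc, h1, IsAffineOpen.fromSpec_top, ← Scheme.isoSpec_Spec_hom,
    Iso.hom_inv_id_assoc]

theorem left_eq_evalAt {X : SchemeOver K} (x : Points X) {U : X.left.Opens}
    (hx : ⊤ ≤ x.left ⁻¹ᵁ U) (hU : IsAffineOpen U) :
    x.left = Spec.map (CommRingCat.ofHom (evalAt x U hx)) ≫ hU.fromSpec := 
  (SpecMap_appLE_top_fromSpec (R := CommRingCat.of K) x.left hx hU).symm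

theorem evalAt_sectionsMap {X : SchemeOver K} (x : Points X) {U : X.left.Opens}
    (hx : ⊤ ≤ x.left ⁻¹ᵁ U) (a : K) : evalAt x U hx (sectionsMap X U a) = a := by
  have h1 : X.hom.appLE ⊤ U le_top ≫ x.left.appLE U ⊤ hx = 𝟙 _ := by
    have h3 : x.left ≫ X.hom = 𝟙 _ := Over.w x
    refine (Scheme.Hom.appLE_comp_appLE ..).trans ?_
    have h4 : ∀ (f : Spec (CommRingCat.of K) ⟶ Spec (CommRingCat.of K)) (e : ⊤ ≤ f ⁻¹ᵁ ⊤),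
        f = 𝟙 _ → f.appLE ⊤ ⊤ e = 𝟙 _ := by
      rintro _ e rfl
      exact (Scheme.Hom.appLE_eq_app ..).trans (Scheme.Hom.id_app ..)
    exact h4 _ _ h3
  have h2 : ((Scheme.ΓSpecIso (CommRingCat.of K)).inv ≫ X.hom.appLE ⊤ U le_top) ≫
      x.left.appLE U ⊤ hx ≫ (Scheme.ΓSpecIso (CommRingCat.of K)).hom = 𝟙 _ := by
    rw [Category.assoc, reassoc_of% h1, Iso.inv_hom_id]
  exact congr($h2 a)

theorem le_preimage_of_mem {X : SchemeOver K} (x : Points X) {U : X.left.Opens}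
    {p : Spec (CommRingCat.of K)} (hp : x.left p ∈ U) : ⊤ ≤ x.left ⁻¹ᵁ U := fun q _ => by
  obtain rfl : p = q := Subsingleton.elim (α := PrimeSpectrum K) p q
  exact hp

theorem evalAt_ne_zero {X : SchemeOver K} (x : Points X) {U : X.left.Opens}
    (hx : ⊤ ≤ x.left ⁻¹ᵁ U) (hU : IsAffineOpen U) {d : Γ(X.left, U)}
    {p : Spec (CommRingCat.of K)} (hp : x.left p ∈ X.left.basicOpen d) : evalAt x U hx d ≠ 0 := by
  rw [left_eq_evalAt x hx hU, Scheme.Hom.comp_apply] at hp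
  have h1 : Spec.map (CommRingCat.ofHom (evalAt x U hx)) p ∈
      hU.fromSpec ⁻¹ᵁ X.left.basicOpen d := hp
  rw [hU.fromSpec_preimage_basicOpen] at h1
  intro h0
  refine h1 ?_
  change evalAt x U hx d ∈ p.asIdeal
  rw [h0]
  exact zero_mem _

/-- A normal variety of positive dimension has a strongly thin set of rational points as soon as
finitely many polynomials show that the base field is not Hilbertian. -/
theorem isStronglyThin_univ [CharZero K] {X : SchemeOver K} (hX : IsNormalVariety X)
    (hdim : 0 < topologicalKrullDim X.left) (Φ : Finset K[X][X])
    (hΦ : ∀ f ∈ Φ, f.Monic ∧ Irreducible f ∧ 2 ≤ f.natDegree) {s : K[X]} (hs : s ≠ 0)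
    (hsΦ : ∀ a, s.eval a ≠ 0 → ∃ f ∈ Φ, ∃ y, f.eval₂ (evalRingHom a) y = 0) :
    IsStronglyThin (Set.univ : Set (Points X)) := by
  have := hX.isIntegral
  have := hX.isSeparated
  have := hX.locallyOfFiniteType
  obtain ⟨U, hU, hne, hint⟩ := exists_isAffineOpen_not_isIntegral X hdim
  let : Algebra K Γ(X.left, U) := (sectionsMap X U).toAlgebra
  have : Algebra.FiniteType K Γ(X.left, U) := finiteType_sectionsMap X hU
  have := isIntegrallyClosed_sections hX.isIntegrallyClosed_stalk hU
  have := functionField_isFractionRing_of_isAffineOpen X.left U hU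
  obtain ⟨G, hG, d, hd0, hd⟩ := exists_finite_not_etale_family (K := K) (A := Γ(X.left, U))
    (fun h => hint h.isIntegral) X.left.functionField Φ hΦ hs hsΦ
  have hZ : ∀ g : G, ∃ (Z : SchemeOver K) (f : Z ⟶ X), IsCover f ∧ IsRamified f ∧
      ∀ (x : Points X) (hx : ⊤ ≤ x.left ⁻¹ᵁ U),
        (∃ x' : integralClosure Γ(X.left, U) (AdjoinRoot (g.1.map
          (algebraMap Γ(X.left, U) X.left.functionField))) →+* K,
          ∀ a, x' (algebraMap _ _ a) = evalAt x U hx a) → x ∈ pointsImage f := fun g => by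
    obtain ⟨hirr, het⟩ := hG g.1 g.2
    have : Fact (Irreducible (g.1.map (algebraMap Γ(X.left, U) X.left.functionField))) := ⟨hirr⟩
    let M := AdjoinRoot (g.1.map (algebraMap Γ(X.left, U) X.left.functionField))
    have : FiniteDimensional X.left.functionField M :=
      (AdjoinRoot.powerBasis hirr.ne_zero).finite
    have := isAffineHom_fieldPoint X M
    exact ⟨normalizationIn X M, fromNormalizationIn X M, isCover_fromNormalizationIn X M hX,
      isRamified_fromNormalizationIn X M hU het, fun x hx ⟨x', hx'⟩ =>
        mem_pointsImage_fromNormalizationIn X M hU x _ (left_eq_evalAt x hx hU) x' hx'⟩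
  choose Z f hcov hram hlift using hZ
  -- The exceptional closed set contains the complement of `U` as well as the zeros of `d` in `U`.
  refine ⟨(X.left.basicOpen d : Set X.left)ᶜ, (X.left.basicOpen d).isOpen.isClosed_compl, ?_,
    Fintype.card G, fun i => Z ((Fintype.equivFin G).symm i),
    fun i => f ((Fintype.equivFin G).symm i), fun i => ⟨hcov _, hram _⟩, fun x _ => ?_⟩
  · intro h
    rw [Set.compl_univ_iff, TopologicalSpace.Opens.coe_eq_empty,
      AlgebraicGeometry.basicOpen_eq_bot_iff] at h
    exact hd0 h
  · by_cases hx : x ∈ pointsIn (X.left.basicOpen d : Set X.left)ᶜ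
    · exact Or.inl hx
    obtain ⟨_, ⟨p, rfl⟩, hp⟩ := Set.not_subset.mp hx
    have hp : x.left p ∈ X.left.basicOpen d := not_not.mp hp
    have hxU := le_preimage_of_mem x (X.left.basicOpen_le d hp)
    let x₀ : Γ(X.left, U) →ₐ[K] K := ⟨evalAt x U hxU, evalAt_sectionsMap x hxU⟩
    obtain ⟨g, hg, hx'⟩ := hd x₀ (evalAt_ne_zero x hxU hU hp)
    refine Or.inr (Set.mem_iUnion.mpr ⟨Fintype.equivFin G ⟨g, hg⟩, ?_⟩)
    beta_reduce
    rw [Equiv.symm_apply_apply]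
    exact hlift ⟨g, hg⟩ x hxU hx'

end HilbertProperty

end

/-! ### From thin sets on a curve to polynomials -/

noncomputable section

namespace HilbertProperty

open Polynomial

variable {K : Type u} [Field K]

/-- A primitive element of `L / F` can be scaled to be integral over `K[X]`. Normality then places
it in `B`, and its minimal polynomial over `K[X]` agrees with the one over `F`. -/
theorem exists_irreducible_aeval_eq_zero [CharZero K] (F L B : Type*) [Field F] [Field L]
    [CommRing B] [IsDomain B] [IsIntegrallyClosed B] [Algebra K[X] F] [IsFractionRing K[X] F]
    [Algebra F L] [Algebra B L] [IsFractionRing B L] [Algebra K[X] B] [Algebra K[X] L]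
    [IsScalarTower K[X] F L] [IsScalarTower K[X] B L] (h : 1 < Module.finrank F L) :
    ∃ f : K[X][X], f.Monic ∧ Irreducible f ∧ 2 ≤ f.natDegree ∧ ∃ b : B, aeval b f = 0 := by
  have : FiniteDimensional F L := FiniteDimensional.of_finrank_pos (zero_lt_one.trans h)
  have : CharZero F := by
    let : Algebra K F := ((algebraMap K[X] F).comp C).toAlgebra
    exact charZero_of_injective_algebraMap (algebraMap K F).injective
  have hinj : Function.Injective (algebraMap K[X] L) := by
    rw [IsScalarTower.algebraMap_eq K[X] F L]
    exact (algebraMap F L).injective.comp (IsFractionRing.injective K[X] F)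
  obtain ⟨α, hα⟩ := Field.exists_primitive_element F L
  have halg : IsAlgebraic K[X] α :=
    (IsFractionRing.isAlgebraic_iff K[X] F L).mpr (Algebra.IsAlgebraic.isAlgebraic α)
  obtain ⟨q, hq0, hq⟩ := halg.exists_integral_multiple
  have hβ : IntermediateField.adjoin F {q • α} = ⊤ := by
    refine top_le_iff.mp (hα ▸ IntermediateField.adjoin_simple_le_iff.mpr ?_)
    have h1 : (algebraMap K[X] F q)⁻¹ • q • α ∈ IntermediateField.adjoin F {q • α} :=
      IntermediateField.smul_mem _ (IntermediateField.mem_adjoin_simple_self F _)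
    have h2 : (algebraMap K[X] F q)⁻¹ • q • α = α := by
      rw [← algebraMap_smul F q α,
        inv_smul_smul₀ ((map_ne_zero_iff _ (IsFractionRing.injective K[X] F)).mpr hq0)]
    rwa [h2] at h1
  obtain ⟨b, hb⟩ := IsIntegrallyClosed.isIntegral_iff.mp (hq.tower_top (A := B))
  have hmin := minpoly.isIntegrallyClosed_eq_field_fractions F L hq
  rw [Algebra.algebraMap_self_apply] at hmin
  refine ⟨minpoly K[X] (q • α), minpoly.monic hq, minpoly.irreducible hq, ?_, b, ?_⟩
  · rw [← (minpoly.monic hq).natDegree_map (algebraMap K[X] F), ← hmin,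
      ← IntermediateField.adjoin.finrank (Algebra.IsIntegral.isIntegral _), hβ,
      IntermediateField.finrank_top']
    exact h
  · refine IsFractionRing.injective B L ?_
    rw [← aeval_algebraMap_apply, hb, minpoly.aeval, map_zero]

theorem fromSpec_comp_hom (X : SchemeOver K) {U : X.left.Opens} (hU : IsAffineOpen U) :
    hU.fromSpec ≫ X.hom = Spec.map (CommRingCat.ofHom (sectionsMap X U)) := by
  have h1 := IsAffineOpen.SpecMap_appLE_fromSpec X.hom (isAffineOpen_top _) hU le_top
  rw [← h1, sectionsMap, CommRingCat.ofHom_hom, Spec.map_comp]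
  congr 1
  rw [IsAffineOpen.fromSpec_top, Scheme.isoSpec_Spec_inv]

/-- The rational point of `X` given by a `K`-homomorphism on the sections over an affine open. -/
def pointOfHom {X : SchemeOver K} {U : X.left.Opens} (hU : IsAffineOpen U)
    (x : Γ(X.left, U) →+* K) (hx : ∀ a, x (sectionsMap X U a) = a) : Points X :=
  Over.homMk (Spec.map (CommRingCat.ofHom x) ≫ hU.fromSpec) (by
    change (Spec.map (CommRingCat.ofHom x) ≫ hU.fromSpec) ≫ X.hom = 𝟙 _
    rw [Category.assoc, fromSpec_comp_hom, ← Spec.map_comp, ← CommRingCat.ofHom_comp,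
      RingHom.ext (f := x.comp (sectionsMap X U)) (g := RingHom.id K) hx]
    exact Spec.map_id _)

theorem le_preimage_pointOfHom {X : SchemeOver K} {U : X.left.Opens} (hU : IsAffineOpen U)
    (x : Γ(X.left, U) →+* K) (hx : ∀ a, x (sectionsMap X U a) = a) :
    ⊤ ≤ (pointOfHom hU x hx).left ⁻¹ᵁ U := fun p _ => by
  change hU.fromSpec (Spec.map (CommRingCat.ofHom x) p) ∈ (U : Set X.left)
  rw [← hU.range_fromSpec]
  exact ⟨_, rfl⟩

theorem SpecMap_fromSpec_injective {R : CommRingCat.{u}} {Y : Scheme.{u}} {U : Y.Opens}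
    (hU : IsAffineOpen U) {x y : Γ(Y, U) ⟶ R}
    (h : Spec.map x ≫ hU.fromSpec = Spec.map y ≫ hU.fromSpec) : x = y :=
  Spec.map_injective ((cancel_mono hU.fromSpec).mp h)

theorem evalAt_pointOfHom {X : SchemeOver K} {U : X.left.Opens} (hU : IsAffineOpen U)
    (x : Γ(X.left, U) →+* K) (hx : ∀ a, x (sectionsMap X U a) = a) :
    evalAt (pointOfHom hU x hx) U (le_preimage_pointOfHom hU x hx) = x := by
  have h1 := left_eq_evalAt (pointOfHom hU x hx) (le_preimage_pointOfHom hU x hx) hU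
  have h2 := SpecMap_fromSpec_injective hU h1
  exact congr($(h2.symm).hom)

theorem mem_basicOpen_pointOfHom {X : SchemeOver K} {U : X.left.Opens} (hU : IsAffineOpen U)
    (x : Γ(X.left, U) →+* K) (hx : ∀ a, x (sectionsMap X U a) = a) {d : Γ(X.left, U)}
    (hd : x d ≠ 0) (p : PrimeSpectrum K) :
    (pointOfHom hU x hx).left p ∈ X.left.basicOpen d := by
  have h1 : Spec.map (CommRingCat.ofHom x) p ∈ hU.fromSpec ⁻¹ᵁ X.left.basicOpen d := by
    rw [hU.fromSpec_preimage_basicOpen]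
    change x d ∉ p.asIdeal
    intro h0
    exact p.isPrime.ne_top (Ideal.eq_top_of_isUnit_mem _ h0 hd.isUnit)
  exact h1

theorem evalAt_comp {X Z : SchemeOver K} (f : Z ⟶ X) (z : Points Z) {U : X.left.Opens}
    (hz : ⊤ ≤ (z ≫ f).left ⁻¹ᵁ U) (hz' : ⊤ ≤ z.left ⁻¹ᵁ f.left ⁻¹ᵁ U) (a : Γ(X.left, U)) :
    evalAt (z ≫ f) U hz a = evalAt z (f.left ⁻¹ᵁ U) hz' (f.left.app U a) := by
  have h1 : (z ≫ f).left.appLE U ⊤ hz = f.left.app U ≫ z.left.appLE (f.left ⁻¹ᵁ U) ⊤ hz' :=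
    Scheme.Hom.comp_appLE ..
  exact congr($(congrArg (· ≫ (Scheme.ΓSpecIso (CommRingCat.of K)).hom) h1) a)

theorem functionFieldMap_germ {Z X : Scheme.{u}} [IsIntegral Z] [IsIntegral X] (f : Z ⟶ X)
    [Surjective f] (U : X.Opens) [Nonempty U] [Nonempty (f ⁻¹ᵁ U)] :
    X.germToFunctionField U ≫ functionFieldMap f =
      f.app U ≫ Z.germToFunctionField (f ⁻¹ᵁ U) := by
  rw [functionFieldMap, Scheme.germToFunctionField, TopCat.Presheaf.germ_stalkSpecializes_assoc]
  exact Scheme.Hom.germ_stalkMap ..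

/-- The polynomial is the minimal equation of an integral primitive element `b` regular on the
preimage of `U`. At a rational point `z` of `Z` above `U`, the value `b(z)` is a root of its
specialization at the coordinate of the image of `z`. -/
theorem exists_polynomial_of_isCover [CharZero K] {Z X : SchemeOver K} {f : Z ⟶ X}
    (hf : IsCover f) (hdeg : 1 < hf.degree) {U : X.left.Opens} (hU : IsAffineOpen U)
    (θ : K[X] ≃+* Γ(X.left, U)) (hθ : ∀ a, θ (C a) = sectionsMap X U a) :
    ∃ F : K[X][X], F.Monic ∧ Irreducible F ∧ 2 ≤ F.natDegree ∧
      ∀ (z : Points Z) (hz : ⊤ ≤ (z ≫ f).left ⁻¹ᵁ U), ∃ y,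
        F.eval₂ (evalRingHom (evalAt (z ≫ f) U hz (θ Polynomial.X))) y = 0 := by
  have := hf.source.isIntegral
  have := hf.target.isIntegral
  have := hf.surjective
  have := hf.isFinite
  have : Nonempty U := by
    by_contra hU0
    obtain rfl : U = ⊥ := by
      rw [← TopologicalSpace.Opens.coe_inj]
      exact Set.isEmpty_coe_sort.mp (not_nonempty_iff.mp hU0)
    have h0 : Subsingleton Γ(X.left, ⊥) := inferInstance
    exact zero_ne_one (θ.injective (Subsingleton.elim (θ 0) (θ 1)))
  have : Nonempty (f.left ⁻¹ᵁ U) := by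
    obtain ⟨x, hx⟩ := ‹Nonempty U›
    obtain ⟨z, rfl⟩ := f.left.surjective x
    exact ⟨⟨z, hx⟩⟩
  have hV : IsAffineOpen (f.left ⁻¹ᵁ U) := hU.preimage f.left
  have := isIntegrallyClosed_sections hf.source.isIntegrallyClosed_stalk hV
  have := functionField_isFractionRing_of_isAffineOpen X.left U hU
  have := functionField_isFractionRing_of_isAffineOpen Z.left _ hV
  let : Algebra X.left.functionField Z.left.functionField :=
    (functionFieldMap f.left).hom.toAlgebra
  let : Algebra K[X] X.left.functionField :=
    ((X.left.germToFunctionField U).hom.comp (θ : K[X] →+* _)).toAlgebra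
  let : Algebra K[X] Γ(Z.left, f.left ⁻¹ᵁ U) :=
    ((f.left.app U).hom.comp (θ : K[X] →+* _)).toAlgebra
  let : Algebra K[X] Z.left.functionField :=
    ((functionFieldMap f.left).hom.comp
      ((X.left.germToFunctionField U).hom.comp (θ : K[X] →+* _))).toAlgebra
  have : IsScalarTower K[X] X.left.functionField Z.left.functionField :=
    IsScalarTower.of_algebraMap_eq fun _ => rfl
  have : IsScalarTower K[X] Γ(Z.left, f.left ⁻¹ᵁ U) Z.left.functionField :=
    IsScalarTower.of_algebraMap_eq fun p => congr($(functionFieldMap_germ f.left U) (θ p))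
  have : IsFractionRing K[X] X.left.functionField :=
    IsFractionRing.of_ringEquiv_left θ fun _ => rfl
  obtain ⟨F, hF, hirr, hF2, b, hb⟩ := exists_irreducible_aeval_eq_zero (K := K)
    X.left.functionField Z.left.functionField Γ(Z.left, f.left ⁻¹ᵁ U) hdeg
  refine ⟨F, hF, hirr, hF2, fun z hz => ?_⟩
  have hz' : ⊤ ≤ z.left ⁻¹ᵁ f.left ⁻¹ᵁ U := hz
  refine ⟨evalAt z (f.left ⁻¹ᵁ U) hz' b, ?_⟩
  have h1 := congrArg (evalAt z (f.left ⁻¹ᵁ U) hz') hb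
  rw [map_zero, aeval_def, hom_eval₂] at h1
  rw [← h1]
  congr 1
  refine Polynomial.ringHom_ext (fun a => ?_) ?_
  · change eval _ (C a) = evalAt z _ hz' (f.left.app U (θ (C a)))
    rw [← evalAt_comp f z hz hz', hθ, evalAt_sectionsMap, eval_C]
  · change eval _ Polynomial.X = evalAt z _ hz' (f.left.app U (θ Polynomial.X))
    rw [← evalAt_comp f z hz hz', eval_X]

/-- If all rational points of a scheme with a dense affine line are thin, then finitely many
polynomials have roots over almost all elements of the base field. -/
theorem exists_polynomials_of_isThin [CharZero K] {X : SchemeOver K}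
    (h : IsThin (Set.univ : Set (Points X))) {U : X.left.Opens} (hU : IsAffineOpen U)
    (hdense : ∀ C : Set X.left, IsClosed C → (U : Set X.left) ⊆ C → C = Set.univ)
    (θ : K[X] ≃+* Γ(X.left, U)) (hθ : ∀ a, θ (C a) = sectionsMap X U a) :
    ∃ Φ : Finset K[X][X], (∀ f ∈ Φ, f.Monic ∧ Irreducible f ∧ 2 ≤ f.natDegree) ∧
      ∃ s : K[X], s ≠ 0 ∧
        ∀ a, s.eval a ≠ 0 → ∃ f ∈ Φ, ∃ y, f.eval₂ (evalRingHom a) y = 0 := by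
  classical
  obtain ⟨D, hD, hDuniv, r, Z, f, hf, hT⟩ := h
  have hF := fun i => exists_polynomial_of_isCover (hf i).choose (hf i).choose_spec hU θ hθ
  choose F hmonic hirr hdeg hroot using hF
  -- Density of `U` gives a nonempty basic open set of some `d` disjoint from `D`; viewed as a
  -- polynomial, `d` serves as `s`.
  obtain ⟨x, hxU, hxD⟩ := Set.not_subset.mp fun hUD => hDuniv (hdense D hD hUD)
  obtain ⟨d, hd, hxd⟩ := hU.exists_basicOpen_le (V := ⟨Dᶜ, hD.isOpen_compl⟩) ⟨x, hxD⟩ hxU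
  refine ⟨Finset.univ.image F, ?_, θ.symm d, ?_, fun a ha => ?_⟩
  · intro p hp
    obtain ⟨i, -, rfl⟩ := Finset.mem_image.mp hp
    exact ⟨hmonic i, hirr i, hdeg i⟩
  · rw [ne_eq, EmbeddingLike.map_eq_zero_iff]
    rintro rfl
    rw [Scheme.basicOpen_zero] at hxd
    exact hxd
  · let e : Γ(X.left, U) →+* K := (evalRingHom a).comp (θ.symm : _ →+* K[X])
    have he : ∀ c, e (sectionsMap X U c) = c := fun c => by
      rw [← hθ]
      simp [e]
    let p := pointOfHom hU e he
    rcases hT (Set.mem_univ p) with hp | hp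
    · exact absurd (hp ⟨_, rfl⟩) (hd (mem_basicOpen_pointOfHom hU e he ha (⊥ : PrimeSpectrum K)))
    · obtain ⟨i, z, hz⟩ := Set.mem_iUnion.mp hp
      have hz' : ⊤ ≤ (z ≫ f i).left ⁻¹ᵁ U := by
        rw [show z ≫ f i = p from hz]
        exact le_preimage_pointOfHom hU e he
      obtain ⟨y, hy⟩ := hroot i z hz'
      refine ⟨F i, Finset.mem_image_of_mem _ (Finset.mem_univ i), y, ?_⟩
      have hev : evalAt (z ≫ f i) U hz' (θ Polynomial.X) = a := by
        have h1 : ∀ (q : Points X) (hq : ⊤ ≤ q.left ⁻¹ᵁ U), q = p → evalAt q U hq = e := by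
          rintro _ hq rfl
          exact evalAt_pointOfHom hU e he
        rw [h1 _ _ hz]
        simp [e]
      rwa [hev] at hy

end HilbertProperty

end

/-! ### The standard chart of the projective line -/

noncomputable section

namespace HilbertProperty

/-- Used with `c = X₀` and `g i = Xᵢ / X₀`, to recover a homogeneous polynomial from its
dehomogenization. -/
theorem eval₂_mul_of_isHomogeneous {σ R S : Type*} [Fintype σ] [CommSemiring R] [CommSemiring S]
    (f : R →+* S) (g : σ → S) (c : S) {φ : MvPolynomial σ R} {n : ℕ} (hφ : φ.IsHomogeneous n) :
    φ.eval₂ f (fun i => c * g i) = c ^ n * φ.eval₂ f g := by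
  rw [MvPolynomial.eval₂_eq', MvPolynomial.eval₂_eq', Finset.mul_sum]
  refine Finset.sum_congr rfl fun d hd => ?_
  simp_rw [mul_pow, Finset.prod_mul_distrib, Finset.prod_pow_eq_pow_sum]
  rw [hφ.degree_eq_sum_deg_support hd,
    Finset.sum_subset d.support.subset_univ fun i _ hi => Finsupp.notMem_support_iff.mp hi]
  ring

variable (K : Type u) [Field K]

attribute [local instance] MvPolynomial.gradedAlgebra

theorem X_mem_homogeneousSubmodule_one (i : Fin 2) :
    (MvPolynomial.X i : MvPolynomial (Fin 2) K) ∈ MvPolynomial.homogeneousSubmodule (Fin 2) K 1 :=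
  MvPolynomial.isHomogeneous_X K i

open HomogeneousLocalization in
/-- The ring of functions on the standard affine chart of the projective line. -/
abbrev ChartRing : Type u :=
  Away (MvPolynomial.homogeneousSubmodule (Fin 2) K) (MvPolynomial.X 0 : MvPolynomial (Fin 2) K)

/-- The coordinate `X₁ / X₀` on the standard chart. -/
def chartCoordinate : ChartRing K :=
  HomogeneousLocalization.Away.mk _ (X_mem_homogeneousSubmodule_one K 0) 1
    (MvPolynomial.X 1) (X_mem_homogeneousSubmodule_one K 1)

/-- The constants on the standard chart. -/
def chartConstants : K →+* ChartRing K :=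
  (HomogeneousLocalization.fromZeroRingHom _ _).comp
    (algebraMap K (MvPolynomial.homogeneousSubmodule (Fin 2) K 0))

/-- The homomorphism from `K[t]` to the chart sending `t` to the coordinate. -/
def polynomialToChart : Polynomial K →+* ChartRing K :=
  Polynomial.eval₂RingHom (chartConstants K) (chartCoordinate K)

/-- The localization of `K[X₀, X₁]` at `X₀`. -/
abbrev ChartLocalization := Localization.Away (MvPolynomial.X 0 : MvPolynomial (Fin 2) K)

/-- Substitution of `X₀ = 1` and `X₁ = t`. -/
def dehomogenize : MvPolynomial (Fin 2) K →+* Polynomial K :=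
  MvPolynomial.eval₂Hom Polynomial.C ![1, Polynomial.X]

/-- The inverse of `polynomialToChart`, induced by dehomogenization. -/
def chartToPolynomial : ChartRing K →+* Polynomial K :=
  (IsLocalization.Away.lift (S := ChartLocalization K) (MvPolynomial.X 0 : MvPolynomial (Fin 2) K)
    (g := dehomogenize K) (by simp [dehomogenize])).comp
      (algebraMap (ChartRing K) (ChartLocalization K))

theorem val_chartConstants (a : K) :
    (chartConstants K a).val =
      algebraMap (MvPolynomial (Fin 2) K) (ChartLocalization K) (MvPolynomial.C a) :=
  rfl

theorem val_chartCoordinate :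
    algebraMap (MvPolynomial (Fin 2) K) (ChartLocalization K) (MvPolynomial.X 0) * (chartCoordinate K).val =
      algebraMap (MvPolynomial (Fin 2) K) (ChartLocalization K) (MvPolynomial.X 1) := by
  rw [chartCoordinate, HomogeneousLocalization.Away.val_mk, Localization.mk_eq_mk',
    IsLocalization.mul_mk'_eq_mk'_of_mul, IsLocalization.mk'_eq_iff_eq_mul, ← map_mul]
  simp [mul_comm]

theorem chartToPolynomial_eq {z : ChartRing K} {x : MvPolynomial (Fin 2) K} {n : ℕ}
    (h : algebraMap (MvPolynomial (Fin 2) K) (ChartLocalization K) (MvPolynomial.X 0) ^ n * z.val =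
      algebraMap (MvPolynomial (Fin 2) K) (ChartLocalization K) x) :
    chartToPolynomial K z = dehomogenize K x := by
  have h0 : IsUnit (dehomogenize K (MvPolynomial.X 0)) := by simp [dehomogenize]
  have h1 := congrArg (IsLocalization.Away.lift (S := ChartLocalization K)
    (MvPolynomial.X 0 : MvPolynomial (Fin 2) K) h0) h
  rw [map_mul, map_pow, IsLocalization.Away.lift_eq, IsLocalization.Away.lift_eq] at h1
  rw [← h1]
  simp [dehomogenize, chartToPolynomial]

theorem chartToPolynomial_polynomialToChart (p : Polynomial K) :
    chartToPolynomial K (polynomialToChart K p) = p := by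
  have h : (chartToPolynomial K).comp (polynomialToChart K) = RingHom.id _ := by
    refine Polynomial.ringHom_ext (fun a => ?_) ?_
    · rw [RingHom.comp_apply, polynomialToChart, Polynomial.coe_eval₂RingHom, Polynomial.eval₂_C,
        chartToPolynomial_eq K (n := 0) (x := MvPolynomial.C a)
          (by rw [pow_zero, one_mul, val_chartConstants])]
      simp [dehomogenize]
    · rw [RingHom.comp_apply, polynomialToChart, Polynomial.coe_eval₂RingHom, Polynomial.eval₂_X,
        chartToPolynomial_eq K (n := 1) (x := MvPolynomial.X 1)
          (by rw [pow_one, val_chartCoordinate])]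
      simp [dehomogenize]
  exact congr($h p)

theorem pow_mul_val_polynomialToChart_dehomogenize {x : MvPolynomial (Fin 2) K} {n : ℕ}
    (hx : x.IsHomogeneous n) :
    algebraMap (MvPolynomial (Fin 2) K) (ChartLocalization K) (MvPolynomial.X 0) ^ n *
        (polynomialToChart K (dehomogenize K x)).val =
      algebraMap (MvPolynomial (Fin 2) K) (ChartLocalization K) x := by
  let c := algebraMap (MvPolynomial (Fin 2) K) (ChartLocalization K) (MvPolynomial.X 0)
  let v := algebraMap (ChartRing K) (ChartLocalization K)
  let ι : K →+* ChartLocalization K :=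
    (algebraMap (MvPolynomial (Fin 2) K) (ChartLocalization K)).comp MvPolynomial.C
  let g : Fin 2 → ChartLocalization K := ![1, (chartCoordinate K).val]
  have h1 : (v.comp (polynomialToChart K)).comp (dehomogenize K) = MvPolynomial.eval₂Hom ι g := by
    refine MvPolynomial.ringHom_ext (fun a => ?_) fun i => ?_
    · simp only [RingHom.comp_apply, dehomogenize, polynomialToChart, MvPolynomial.coe_eval₂Hom,
        MvPolynomial.eval₂_C, Polynomial.coe_eval₂RingHom, Polynomial.eval₂_C]
      exact val_chartConstants K a
    · fin_cases i
      · simp [dehomogenize, g]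
      · simp [dehomogenize, g, polynomialToChart]
        rfl
  have h2 : algebraMap (MvPolynomial (Fin 2) K) (ChartLocalization K) =
      MvPolynomial.eval₂Hom ι fun i => c * g i := by
    refine MvPolynomial.ringHom_ext (fun a => by simp [ι]) fun i => ?_
    fin_cases i
    · simp [g, c]
    · simpa [g, c] using (val_chartCoordinate K).symm
  have h3 := eval₂_mul_of_isHomogeneous ι g c hx
  refine Eq.trans ?_ (h3.symm.trans congr($h2.symm x))
  exact congrArg (c ^ n * ·) congr($h1 x)

theorem polynomialToChart_surjective : Function.Surjective (polynomialToChart K) := by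
  intro z
  obtain ⟨n, x, hx, rfl⟩ := HomogeneousLocalization.Away.mk_surjective _
    (X_mem_homogeneousSubmodule_one K 0) z
  refine ⟨dehomogenize K x, HomogeneousLocalization.val_injective _ ?_⟩
  rw [HomogeneousLocalization.Away.val_mk, Localization.mk_eq_mk',
    IsLocalization.eq_mk'_iff_mul_eq, mul_comm, map_pow]
  rw [smul_eq_mul, mul_one] at hx
  exact pow_mul_val_polynomialToChart_dehomogenize K hx

/-- The chart has coordinate ring `K[t]`. -/
def chartEquiv : Polynomial K ≃+* ChartRing K :=
  RingEquiv.ofBijective (polynomialToChart K)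
    ⟨Function.LeftInverse.injective (chartToPolynomial_polynomialToChart K), polynomialToChart_surjective K⟩

/-- The standard affine chart of the projective line. -/
def chart : (projectiveLine K).left.Opens :=
  Proj.basicOpen (MvPolynomial.homogeneousSubmodule (Fin 2) K) (MvPolynomial.X 0)

theorem isAffineOpen_chart : IsAffineOpen (chart K) :=
  Proj.isAffineOpen_basicOpen _ _ (X_mem_homogeneousSubmodule_one K 0) zero_lt_one

/-- The sections of the projective line over the chart are `K[t]`. -/
def chartSections : Polynomial K ≃+* Γ((projectiveLine K).left, chart K) :=
  (chartEquiv K).trans (Proj.basicOpenIsoAway (MvPolynomial.homogeneousSubmodule (Fin 2) K) _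
    (X_mem_homogeneousSubmodule_one K 0) zero_lt_one).commRingCatIsoToRingEquiv

/-- Both sides describe the structure morphism of the chart over `Spec K`, one through the
degree-zero part of the graded ring and one through sections; faithfulness of `Spec` identifies the
ring maps. -/
theorem chartSections_C (a : K) :
    chartSections K (Polynomial.C a) = sectionsMap (projectiveLine K) (chart K) a := by
  let 𝒜 := MvPolynomial.homogeneousSubmodule (Fin 2) K
  let U := Proj.basicOpen 𝒜 (MvPolynomial.X 0)
  let e := Proj.basicOpenIsoSpec 𝒜 _ (X_mem_homogeneousSubmodule_one K 0) zero_lt_one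
  let ι := Proj.awayι 𝒜 _ (X_mem_homogeneousSubmodule_one K 0) zero_lt_one
  have hU : IsAffineOpen U := isAffineOpen_chart K
  have h1 : Spec.map (Proj.awayToSection 𝒜 (MvPolynomial.X 0)) ≫ ι = hU.fromSpec := by
    rw [← cancel_epi hU.isoSpec.hom, hU.isoSpec_hom_fromSpec]
    exact e.hom_inv_id_assoc U.ι
  have h2 := fromSpec_comp_hom (projectiveLine K) (isAffineOpen_chart K)
  let α := CommRingCat.ofHom (algebraMap K (𝒜 0))
  let β := CommRingCat.ofHom
    (HomogeneousLocalization.fromZeroRingHom 𝒜 (.powers (MvPolynomial.X 0)))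
  have h3 : hU.fromSpec ≫ Proj.toSpecZero 𝒜 ≫ Spec.map α =
      Spec.map (α ≫ β ≫ Proj.awayToSection 𝒜 (MvPolynomial.X 0)) := by
    rw [← h1, Category.assoc, Proj.awayι_toSpecZero_assoc, Spec.map_comp, Spec.map_comp,
      Category.assoc]
  have h4 := Spec.map_injective (h3.symm.trans h2)
  have h5 : polynomialToChart K (Polynomial.C a) = chartConstants K a :=
    Polynomial.eval₂_C _ _
  refine Eq.trans ?_ congr($h4 a)
  exact congrArg (Proj.awayToSection 𝒜 (MvPolynomial.X 0)) h5

theorem eq_univ_of_chart_subset (C : Set (projectiveLine K).left) (hC : IsClosed C)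
    (h : (chart K : Set (projectiveLine K).left) ⊆ C) : C = Set.univ := by
  -- The zero ideal is the generic point. It lies in the chart because `X₀ ≠ 0`, and its closure is
  -- everything.
  let η : ProjectiveSpectrum (MvPolynomial.homogeneousSubmodule (Fin 2) K) :=
    { asHomogeneousIdeal := ⊥
      isPrime := by
        rw [HomogeneousIdeal.toIdeal_bot]
        exact Ideal.isPrime_bot
      not_irrelevant_le := fun hle => MvPolynomial.X_ne_zero (R := K) (0 : Fin 2) (hle <| by
        rw [HomogeneousIdeal.mem_irrelevant_iff, GradedRing.proj_apply,
          DirectSum.decompose_of_mem_ne _ (X_mem_homogeneousSubmodule_one K 0) one_ne_zero]) }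
  have hη : η ∈ C := h fun h0 => MvPolynomial.X_ne_zero (R := K) (0 : Fin 2) h0
  refine Set.eq_univ_of_forall fun y => ?_
  let y' : ProjectiveSpectrum (MvPolynomial.homogeneousSubmodule (Fin 2) K) := y
  have hy : y' ∈ closure {η} := (ProjectiveSpectrum.le_iff_mem_closure _ η y').mp
    ((ProjectiveSpectrum.as_ideal_le_as_ideal _ η y').mp bot_le)
  exact hC.closure_subset_iff.mpr (Set.singleton_subset_iff.mpr hη) hy

end HilbertProperty

end

theorem mainTheorem9 (K : Type u) [Field K] [CharZero K]
    (h : ∃ X : HilbertProperty.SchemeOver K, HilbertProperty.IsNormalVariety X ∧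
      0 < topologicalKrullDim X.left ∧ HilbertProperty.HasWHP X) :
    HilbertProperty.IsHilbertian K := by
  intro hthin
  obtain ⟨X, hX, hdim, hwhp⟩ := h
  obtain ⟨Φ, hΦ, s, hs, hsΦ⟩ := HilbertProperty.exists_polynomials_of_isThin hthin
    (HilbertProperty.isAffineOpen_chart K) (HilbertProperty.eq_univ_of_chart_subset K)
    (HilbertProperty.chartSections K) (HilbertProperty.chartSections_C K)
  exact hwhp (HilbertProperty.isStronglyThin_univ hX hdim Φ hΦ hs hsΦ)
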